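/- Consider an episodic MDP with finite state space $\mathcal S$ and finite action space $\mathcal A$, fixed initial state $S_0$, absorbing terminal state $0$, transition probabilities $p(\cdot\mid s,a)$, reward $r:\mathcal S\times\mathcal A\times\mathcal S\to[-r_{\max},r_{\max}]$ with $r_{\max}>0$, and discount factor $\gamma\in(0,1)$. Let $\{\pi_\theta(a\mid s)\}_{\theta\in\mathbb R^d}$ be stochastic policies with $\pi_\theta(a\mid s)>0$ and $\theta\mapsto\log\pi_\theta(a\mid s)$ twice differentiable, such that for all $\theta,a,s$ $$\|\nabla\log\pi_\theta(a\mid s)\|\le M_d,\qquad \|\nabla^2\log\pi_\theta(a\mid s)\|\le M_h .$$ Let $T$ be the first time the state $0$ is reached, and suppose that for every $\theta$, $T\le M_e$ almost surely under $\pi_\theta$. Let $g:[0,1]\to[0,1]$ be non-decreasing with $g(0)=0$, $g(1)=1$, twice differentiable on $(0,1)$ with $|g'|\le M_{g'}$ and $|g''|\le M_{g''}$ there, and right-differentiable at $0$ (write $g'(0)$ for this right derivative). All constants $M_d,M_h,M_e,M_{g'},M_{g''}$ are positive. Let $R^\theta=\sum_{t=0}^{T-1}\gamma^t r(S_t,A_t,S_{t+1})$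 be the discounted reward of an episode under $\pi_\theta$, $F_{R^\theta}$ its CDF, $M_r=r_{\max}/(1-\gamma)$, and $$\rho_g(\theta)=\int_{-M_r}^0\big(g(1-F_{R^\theta}(x))-1\big)dx+\int_0^{M_r}g(1-F_{R^\theta}(x))\,dx,\qquad \rho_g^*=\sup_{\theta\in\mathbb R^d}\rho_g(\theta).$$ For $m$ independent episodes under $\pi_\theta$ with rewards $R_i$, lengths $T^i$, states $S^i_t$ and actions $A^i_t$, put $$G^m(x)=\frac1m\sum_{i=1}^m\mathbf 1\{R_i\le x\},\qquad \widehat\nabla G^m(x)=\frac1m\sum_{i=1}^m\mathbf 1\{R_i\le x\}\sum_{t=0}^{T^i-1}\nabla\log\pi_\theta(A^i_t\mid S^i_t),$$ $$\widehat\nabla\rho_g(\theta)=-\int_{-M_r}^{M_r}g'(1-G^m(x))\,\widehat\nabla G^m(x)\,dx$$ (where $G^m(x)=0$ the integrand is $0$, since $\widehat\nabla G^m(x)=0$ there). The on-policy algorithm starts at a fixed $\theta_0\in\mathbb R^d$; at each iteration it draws a fresh batch of $m$ independent episodes from $\pi_{\theta_k}$ and sets $\theta_{k+1}=\theta_k+\alpha\,\widehat\nabla\rho_g(\theta_k)$.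 Its output after $N\ge1$ iterations is $\theta_R$ with $R$ uniform on $\{1,\dots,N\}$, independent of the iterates. Then $\rho_g$ is differentiable and bounded above, and with $$L_{\rho'}=2M_rM_e\big(M_hM_{g'}+M_eM_d^2(M_{g'}+M_{g''})\big),$$ $$C=2(\rho_g^*-\rho_g(\theta_0))+4M_r^2M_e^2M_d^2\big(M_{g'}^2L_{\rho'}+8(e^2M_{g'}^2+M_{g''}^2)\big),$$ the following holds. For every $N\ge1$, if $\alpha=1/\sqrt N$ and $m=\lceil\sqrt N\rceil$ (so $m=\sqrt N$ when $N$ is a perfect square), then $$\mathbb E\|\nabla\rho_g(\theta_R)\|^2\le\frac{C}{\sqrt N}.$$ Consequently, for every $\varepsilon>0$ and every $N\ge1$ with $N\ge C^2/\varepsilon^2$, the output $\theta_R$ with these choices is an $\varepsilon$-stationary point, i.e. $\mathbb E\|\nabla\rho_g(\theta_R)\|^2\le\varepsilon$; thus $O(1/\varepsilon^2)$ iterations suffice. -/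

import Mathlib

open scoped ENNReal
open Classical in
/-- The law of `m` independent draws from `p`. -/
noncomputable def iidLaw {α : Type*} (p : PMF α) (m : ℕ) : PMF (Fin m → α) :=
  ⟨fun w => ∏ i, p (w i), by
    rw [ENNReal.summable.hasSum_iff]
    induction m with
    | zero => rw [tsum_eq_single default (fun b hb => (hb (Subsingleton.elim _ _)).elim)]; simp
    | succ m ih =>
      rw [← (Fin.consEquiv (fun _ : Fin (m + 1) => α)).tsum_eq, ENNReal.tsum_prod']
      simp only [Fin.consEquiv_apply, Fin.prod_univ_succ, Fin.cons_zero, Fin.cons_succ,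
        ENNReal.tsum_mul_left, ih, mul_one, p.tsum_coe]⟩

/-- The parameter space `ℝ^d` with its Euclidean norm. -/
abbrev Param (d : ℕ) : Type := EuclideanSpace ℝ (Fin d)

/-- An episodic Markov decision process: transition law `trans s a` of the next state, reward
`reward s a s'`, fixed initial state, and a terminal absorbing state. -/
structure EpisodicMDP (S A : Type*) where
  trans : S → A → PMF S
  reward : S → A → S → ℝ
  start : S
  term : S
  absorbing : ∀ a, trans term a = PMF.pure term

/-- A finite episode: its length `n`, its states `S_0, …, S_n`, its actions `A_0, …, A_{n-1}`. -/
abbrev Episode (S A : Type*) : Type _ := Σ n : ℕ, (Fin (n + 1) → S) × (Fin n → A)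

namespace EpisodicMDP

variable {S A : Type*} (M : EpisodicMDP S A) (q : S → PMF A)

open Classical in
/-- Probability, under the stationary policy `q` and initial state `s₀`, that the process reaches
the terminal state for the first time at time `n` along the given states and actions:
`∏_{t<n} q(A_t | S_t) p(S_{t+1} | S_t, A_t)` if the path starts at `s₀` and visits the terminal
state exactly at its last time, and `0` otherwise. -/
noncomputable def episodeProb (s₀ : S) (ω : Episode S A) : ℝ≥0∞ :=
  if ω.2.1 0 = s₀ ∧ ∀ t, ω.2.1 t = M.term ↔ t = Fin.last ω.1 then
    ∏ t : Fin ω.1, q (ω.2.1 t.castSucc) (ω.2.2 t) *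
      M.trans (ω.2.1 t.castSucc) (ω.2.2 t) (ω.2.1 t.succ)
  else 0

open Classical in
theorem episodeProb_cons {n : ℕ} (s x : S) (τ : Fin (n + 1) → S) (a : A) (β : Fin n → A) :
    M.episodeProb q s ⟨n + 1, Fin.cons x τ, Fin.cons a β⟩ ≤
      (if x = s then q s a else 0) * ∑' s', M.trans s a s' * M.episodeProb q s' ⟨n, τ, β⟩ := by
  refine le_trans ?_ (mul_le_mul_right (ENNReal.le_tsum (τ 0)) _)
  unfold episodeProb
  by_cases h : (Fin.cons x τ : Fin (n + 2) → S) 0 = s ∧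
      ∀ t, (Fin.cons x τ : Fin (n + 2) → S) t = M.term ↔ t = Fin.last (n + 1)
  · have h1 : x = s := by simpa using h.1
    have h2 : ∀ t, τ t = M.term ↔ t = Fin.last n := by
      intro t
      have := h.2 t.succ
      rwa [Fin.cons_succ, ← Fin.succ_last, Fin.succ_inj] at this
    subst h1
    simp only [h2]
    rw [if_pos (by simpa using h.2)]
    simp [Fin.prod_univ_succ, mul_assoc]
  · rw [if_neg h]; exact zero_le

open Classical in
theorem tsum_episodeProb_succ_le (n : ℕ) (s : S) :
    ∑' e : (Fin (n + 2) → S) × (Fin (n + 1) → A), M.episodeProb q s ⟨n + 1, e⟩ ≤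
      ∑' a, q s a * ∑' s', M.trans s a s' *
        ∑' e : (Fin (n + 1) → S) × (Fin n → A), M.episodeProb q s' ⟨n, e⟩ := by
  rw [← (((Fin.consEquiv (fun _ : Fin (n + 2) => S))).prodCongr
    ((Fin.consEquiv (fun _ : Fin (n + 1) => A)))).tsum_eq]
  simp only [Equiv.prodCongr_apply, ENNReal.tsum_prod', Prod.map]
  calc _ ≤ ∑' (x : S) (τ : Fin (n + 1) → S) (a : A) (β : Fin n → A),
        (if x = s then q s a else 0) *
          ∑' s', M.trans s a s' * M.episodeProb q s' ⟨n, τ, β⟩ :=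
        ENNReal.tsum_le_tsum fun x => ENNReal.tsum_le_tsum fun τ =>
          ENNReal.tsum_le_tsum fun a => ENNReal.tsum_le_tsum fun β =>
            M.episodeProb_cons q s x τ a β
    _ = _ := by
        rw [tsum_eq_single s (fun x hx => by simp [hx])]
        simp only [if_true]
        rw [ENNReal.tsum_comm]
        refine tsum_congr fun a => ?_
        simp only [ENNReal.tsum_mul_left]
        congr 1
        simp only [← ENNReal.tsum_mul_left]
        calc _ = ∑' (τ : Fin (n + 1) → S) (s' : S) (β : Fin n → A),
              M.trans s a s' * M.episodeProb q s' ⟨n, τ, β⟩ :=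
              tsum_congr fun τ => ENNReal.tsum_comm
          _ = _ := ENNReal.tsum_comm

theorem tsum_episodeProb_term_succ (n : ℕ) :
    ∑' e : (Fin (n + 2) → S) × (Fin (n + 1) → A), M.episodeProb q M.term ⟨n + 1, e⟩ = 0 := by
  refine ENNReal.tsum_eq_zero.2 fun e => if_neg fun h => ?_
  exact absurd ((h.2 0).1 h.1) (Fin.last_pos.ne)

open Classical in
theorem tsum_episodeProb_zero (s : S) :
    ∑' e : (Fin 1 → S) × (Fin 0 → A), M.episodeProb q s ⟨0, e⟩ ≤ if s = M.term then 1 else 0 := by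
  rw [tsum_eq_single (fun _ => s, Fin.elim0)]
  · unfold episodeProb
    split_ifs with h h' h'
    · simp
    · exact absurd (h.1.symm.trans ((h.2 0).2 rfl)) h'
    · exact zero_le
    · exact le_rfl
  · rintro ⟨e, f⟩ he
    refine if_neg fun h => he ?_
    refine Prod.ext (funext fun t => ?_) (Subsingleton.elim _ _)
    rw [Subsingleton.elim t 0]; exact h.1

open Classical in
theorem sum_range_episodeProb_le_one (n : ℕ) : ∀ s : S,
    ∑ k ∈ Finset.range n,
      ∑' e : (Fin (k + 1) → S) × (Fin k → A), M.episodeProb q s ⟨k, e⟩ ≤ 1 := by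
  induction n with
  | zero => simp
  | succ n ih =>
    intro s
    rw [Finset.sum_range_succ']
    have h0 := M.tsum_episodeProb_zero q s
    by_cases hs : s = M.term
    · subst hs
      rw [Finset.sum_eq_zero fun k _ => M.tsum_episodeProb_term_succ q k, zero_add]
      simpa using h0
    · rw [if_neg hs] at h0
      calc _ ≤ (∑ k ∈ Finset.range n, ∑' a, q s a * ∑' s', M.trans s a s' *
            ∑' e : (Fin (k + 1) → S) × (Fin k → A), M.episodeProb q s' ⟨k, e⟩) + 0 :=
            add_le_add (Finset.sum_le_sum fun k _ => M.tsum_episodeProb_succ_le q k s) h0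
        _ = ∑' a, q s a * ∑' s', M.trans s a s' * ∑ k ∈ Finset.range n,
            ∑' e : (Fin (k + 1) → S) × (Fin k → A), M.episodeProb q s' ⟨k, e⟩ := by
            rw [add_zero, ← Summable.tsum_finsetSum fun _ _ => ENNReal.summable]
            refine tsum_congr fun a => ?_
            rw [← Finset.mul_sum, ← Summable.tsum_finsetSum fun _ _ => ENNReal.summable]
            simp only [Finset.mul_sum]
        _ ≤ ∑' a, q s a * ∑' s', M.trans s a s' * 1 :=
            ENNReal.tsum_le_tsum fun a => mul_le_mul_right
              (ENNReal.tsum_le_tsum fun s' => mul_le_mul_right (ih s') _) _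
        _ = 1 := by simp [PMF.tsum_coe]

theorem tsum_episodeProb_le_one (s : S) : ∑' ω, M.episodeProb q s ω ≤ 1 := by
  rw [ENNReal.tsum_sigma']
  exact ENNReal.tsum_le_of_sum_range_le fun n => M.sum_range_episodeProb_le_one q n s

/-- The law of an episode under the policy `q`: `some ω` is the episode `ω` run until the terminal
state is first reached; `none` is the event that the terminal state is never reached, which
carries the remaining probability. -/
noncomputable def episodeLaw : PMF (Option (Episode S A)) :=
  ⟨fun o => o.elim (1 - ∑' ω, M.episodeProb q M.start ω) (M.episodeProb q M.start), by
    rw [ENNReal.summable.hasSum_iff, ← (Equiv.optionEquivSumPUnit.{0} _).symm.tsum_eq,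
      Summable.tsum_sum ENNReal.summable ENNReal.summable, add_comm]
    simp only [Equiv.optionEquivSumPUnit_symm_inl, Equiv.optionEquivSumPUnit_symm_inr,
      Option.elim_some, Option.elim_none, tsum_fintype, Finset.univ_unique, Finset.sum_singleton]
    exact tsub_add_cancel_of_le (M.tsum_episodeProb_le_one q M.start)⟩

/-- The length `T` of an episode, `∞` if the terminal state is never reached. -/
noncomputable def episodeLength : Option (Episode S A) → ℝ≥0∞
  | none => ⊤
  | some ω => (ω.1 : ℝ≥0∞)

/-- The cumulative discounted reward `R = ∑_{t<T} γ^t r(S_t, A_t, S_{t+1})` of an episode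
(by convention `0` if the terminal state is never reached). -/
noncomputable def discountedReward (γ : ℝ) : Option (Episode S A) → ℝ
  | none => 0
  | some ω => ∑ t : Fin ω.1,
      γ ^ (t : ℕ) * M.reward (ω.2.1 t.castSucc) (ω.2.2 t) (ω.2.1 t.succ)

/-- The CDF of the cumulative discounted reward under the policy `q`. -/
noncomputable def rewardCDF (γ : ℝ) (x : ℝ) : ℝ :=
  ProbabilityTheory.cdf ((M.episodeLaw q).map (M.discountedReward γ)).toMeasure x

end EpisodicMDP

/-- `g : [0,1] → [0,1]` is a distortion function (values outside `[0,1]` are irrelevant). -/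
structure IsDistortion (g : ℝ → ℝ) : Prop where
  mono : MonotoneOn g (Set.Icc 0 1)
  zero : g 0 = 0
  one : g 1 = 1

/-- The derivative of `g` on `[0,1]`: two-sided inside, the right derivative `g'₊(0)` at `0`. -/
noncomputable def distDeriv (g : ℝ → ℝ) (t : ℝ) : ℝ := derivWithin g (Set.Icc 0 1) t

section DRM

variable {S A : Type*} {d : ℕ} (M : EpisodicMDP S A) (π : Param d → S → PMF A) (g : ℝ → ℝ)
  (γ Mr : ℝ)

/-- The distortion risk measure `ρ_g(θ)` of the cumulative reward under the policy `π θ`. -/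
noncomputable def drm (θ : Param d) : ℝ :=
  (∫ x in (-Mr)..0, (g (1 - M.rewardCDF (π θ) γ x) - 1)) +
    ∫ x in (0 : ℝ)..Mr, g (1 - M.rewardCDF (π θ) γ x)

/-- `log π_θ(a | s)` as a function of `θ`. -/
noncomputable def logPolicy (s : S) (a : A) (θ : Param d) : ℝ := Real.log (π θ s a).toReal

/-- `∑_{t<T} ∇ log π_θ(A_t | S_t)` along an episode. -/
noncomputable def episodeScore (θ : Param d) : Option (Episode S A) → Param d
  | none => 0
  | some ω => ∑ t : Fin ω.1, gradient (logPolicy π (ω.2.1 t.castSucc) (ω.2.2 t)) θ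

open Classical in
/-- The empirical distribution function of the rewards of a batch of `m` episodes. -/
noncomputable def empCDF {m : ℕ} (w : Fin m → Option (Episode S A)) (x : ℝ) : ℝ :=
  (m : ℝ)⁻¹ * ∑ i, if M.discountedReward γ (w i) ≤ x then 1 else 0

open Classical in
/-- The likelihood-ratio estimate of the gradient of the CDF from a batch of `m` episodes. -/
noncomputable def empGradCDF {m : ℕ} (θ : Param d) (w : Fin m → Option (Episode S A)) (x : ℝ) :
    Param d :=
  (m : ℝ)⁻¹ • ∑ i, if M.discountedReward γ (w i) ≤ x then episodeScore π θ (w i) else 0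

/-- The on-policy estimate of `∇ ρ_g(θ)` from a batch of `m` episodes. -/
noncomputable def drmGradEstimate {m : ℕ} (θ : Param d) (w : Fin m → Option (Episode S A)) :
    Param d :=
  -∫ x in (-Mr)..Mr, distDeriv g (1 - empCDF M γ w x) • empGradCDF M π γ θ w x

/-- The law of the `k`-th iterate of the on-policy algorithm: from `θ_k`, draw `m` fresh
independent episodes from `π_{θ_k}` and set `θ_{k+1} = θ_k + α · (gradient estimate at θ_k)`. -/
noncomputable def iterateLaw (α : ℝ) (m : ℕ) (θ₀ : Param d) : ℕ → PMF (Param d)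
  | 0 => PMF.pure θ₀
  | k + 1 => (iterateLaw α m θ₀ k).bind fun θ =>
      (iidLaw (M.episodeLaw (π θ)) m).map fun w => θ + α • drmGradEstimate M π g γ Mr θ w

/-- The law of the output `θ_R`, `R` uniform on `{1, …, N}`, independent of the iterates. -/
noncomputable def outputLaw (α : ℝ) (m : ℕ) (θ₀ : Param d) (N : ℕ) (hN : 1 ≤ N) :
    PMF (Param d) :=
  (PMF.uniformOfFinset (Finset.Icc 1 N) (Finset.nonempty_Icc.2 hN)).bind
    (iterateLaw M π g γ Mr α m θ₀)

/-- `E ‖∇ ρ_g(θ)‖²` for a random parameter `θ` with (discrete) law `μ`. -/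
noncomputable def meanSqGrad (μ : PMF (Param d)) : ℝ≥0∞ :=
  ∑' θ, μ θ * ENNReal.ofReal (‖gradient (drm M π g γ Mr) θ‖ ^ 2)

/-- A random parameter with law `μ` is an `ε`-stationary point: `E ‖∇ ρ_g(θ)‖² ≤ ε`. -/
def IsStationaryPoint (ε : ℝ) (μ : PMF (Param d)) : Prop :=
  meanSqGrad M π g γ Mr μ ≤ ENNReal.ofReal ε

end DRM

/-!
Almost surely, only finitely many episodes can occur, and these are the same for every parameter.
Hence the distortion risk measure is a weighted finite sum of terms `g (1 - P_θ(U))` over events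
`U`, and its gradient is the sum of the terms `-g' (1 - P_θ(U)) ∇P_θ(U)`, in which
`∇P_θ(U) = E_θ[1_U ∇ log P_θ]` is bounded and Lipschitz by the bounds on the score and its
derivative. Averages over `m` independent episodes estimate `P_θ(U)` and `∇P_θ(U)` with mean
squared error `O(1 / m)`, so the plug-in estimate of the gradient has mean squared error `O(1 / m)`
as well. For a step size `α ≤ 1 / L`, where `L` is the Lipschitz constant of the gradient, one step
raises the objective by at least `α / 2 * (‖gradient‖ ^ 2 - ‖error‖ ^ 2)`, and these inequalities
telescope. If `√N < L`, the step size `1 / √N` is too long for this, but then the uniform bound on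
the gradient already implies the claim.
-/

open MeasureTheory Set Filter Topology
open scoped InnerProductSpace

section Sublevel

variable {Ω : Type*} [Fintype Ω]

open Classical in
/-- The finite set of outcomes at which `R` is at most `x`. A CDF at level `x` is the probability of
this event, so integrals of functions of CDFs become sums over events. -/
noncomputable def sublevel (R : Ω → ℝ) (x : ℝ) : Finset Ω := {ω | R ω ≤ x}

theorem mem_sublevel {R : Ω → ℝ} {x : ℝ} {ω : Ω} : ω ∈ sublevel R x ↔ R ω ≤ x := by
  simp [sublevel]

theorem measurable_sublevel (R : Ω → ℝ) : Measurable (sublevel R) :=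
  measurable_finset_iff.2 fun ω => by
    simp only [mem_sublevel]
    exact measurableSet_setOfPred.1 measurableSet_Ici

/-- The length of the set of levels in `(a, b]` at which the sublevel set of `R` is `U`. -/
noncomputable def sublevelWeight (R : Ω → ℝ) (a b : ℝ) (U : Finset Ω) : ℝ :=
  ((volume.restrict (Ioc a b)).map (sublevel R)).real {U}

theorem sublevelWeight_nonneg (R : Ω → ℝ) (a b : ℝ) (U : Finset Ω) : 0 ≤ sublevelWeight R a b U :=
  measureReal_nonneg

variable {E : Type*} [NormedAddCommGroup E]

theorem intervalIntegrable_comp_sublevel (R : Ω → ℝ) (Φ : Finset Ω → E) (a b : ℝ) :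
    IntervalIntegrable (fun x => Φ (sublevel R x)) volume a b :=
  ⟨Integrable.of_finite.comp_measurable (measurable_sublevel R),
    Integrable.of_finite.comp_measurable (measurable_sublevel R)⟩

theorem integral_comp_sublevel [NormedSpace ℝ E] [CompleteSpace E] (R : Ω → ℝ)
    (Φ : Finset Ω → E) {a b : ℝ} (hab : a ≤ b) :
    ∫ x in a..b, Φ (sublevel R x) = ∑ U, sublevelWeight R a b U • Φ U := by
  have hΦ : Integrable Φ ((volume.restrict (Ioc a b)).map (sublevel R)) := .of_finite
  rw [intervalIntegral.integral_of_le hab,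
    ← integral_map (measurable_sublevel R).aemeasurable hΦ.aestronglyMeasurable,
    integral_fintype hΦ]
  rfl

theorem sum_sublevelWeight (R : Ω → ℝ) {a b : ℝ} (hab : a ≤ b) :
    ∑ U, sublevelWeight R a b U = b - a := by
  simpa using (integral_comp_sublevel R (fun _ => (1 : ℝ)) hab).symm

end Sublevel

section OneSidedDerivative

variable {f : ℝ → ℝ} {f' a b : ℝ}

theorem mem_closure_image_deriv_of_hasDerivWithinAt (hab : a < b)
    (hf : DifferentiableOn ℝ f (Ioo a b)) (ha : HasDerivWithinAt f f' (Ico a b) a) :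
    f' ∈ closure (deriv f '' Ioo a b) := by
  have hslope : Tendsto (slope f a) (𝓝[>] a) (𝓝 f') := by
    rw [← nhdsWithin_Ioo_eq_nhdsGT hab]
    exact (hasDerivWithinAt_iff_tendsto_slope' (by simp)).1 (ha.mono Ioo_subset_Ico_self)
  refine mem_closure_of_tendsto hslope ?_
  filter_upwards [Ioo_mem_nhdsGT hab] with x hx
  have hcont : ContinuousOn f (Icc a x) := fun y hy => by
    rcases hy.1.eq_or_lt with rfl | hay
    · exact ha.continuousWithinAt.mono fun z hz => ⟨hz.1, hz.2.trans_lt hx.2⟩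
    · exact (hf.continuousOn.continuousAt
        (Ioo_mem_nhds hay (hy.2.trans_lt hx.2))).continuousWithinAt
  obtain ⟨ξ, hξ, hslope_eq⟩ := exists_deriv_eq_slope f hx.1 hcont
    (hf.mono (Ioo_subset_Ioo_right hx.2.le))
  exact ⟨ξ, ⟨hξ.1, hξ.2.trans hx.2⟩, hslope_eq.trans (slope_def_field f a x).symm⟩

end OneSidedDerivative

/-- A function `g` that is differentiable on `[0, 1)`, one-sidedly at `0`, with derivative bounded
by `B₁` and `B₂`-Lipschitz. Nothing is asked of `g` at `1` (not even continuity), where a distortion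
function may have an infinite slope. -/
structure IsSmoothDistortion (g : ℝ → ℝ) (B₁ B₂ : ℝ) : Prop where
  differentiableWithinAt : ∀ t ∈ Ico (0 : ℝ) 1, DifferentiableWithinAt ℝ g (Icc 0 1) t
  abs_distDeriv_le : ∀ t ∈ Ico (0 : ℝ) 1, |distDeriv g t| ≤ B₁
  abs_distDeriv_sub_le : ∀ s ∈ Ico (0 : ℝ) 1, ∀ t ∈ Ico (0 : ℝ) 1,
    |distDeriv g s - distDeriv g t| ≤ B₂ * |s - t|

theorem distDeriv_eq_deriv {g : ℝ → ℝ} {t : ℝ} (ht : t ∈ Ioo (0 : ℝ) 1) :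
    distDeriv g t = deriv g t :=
  derivWithin_of_mem_nhds (Icc_mem_nhds ht.1 ht.2)

section SecondDerivative

variable {g : ℝ → ℝ} {B₁ B₂ : ℝ}

theorem distDeriv_zero_mem_closure (hg₀ : DifferentiableWithinAt ℝ g (Icc 0 1) 0)
    (hg₁ : ∀ t ∈ Ioo (0 : ℝ) 1, DifferentiableAt ℝ g t) {u : ℝ} (hu : u ∈ Ioc (0 : ℝ) 1) :
    distDeriv g 0 ∈ closure (deriv g '' Ioo 0 u) :=
  mem_closure_image_deriv_of_hasDerivWithinAt hu.1
    (fun t ht => (hg₁ t ⟨ht.1, ht.2.trans_le hu.2⟩).differentiableWithinAt)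
    (hg₀.hasDerivWithinAt.mono fun _ ht => ⟨ht.1, (ht.2.trans_le hu.2).le⟩)

theorem abs_distDeriv_sub_deriv_le (hg₀ : DifferentiableWithinAt ℝ g (Icc 0 1) 0)
    (hg₁ : ∀ t ∈ Ioo (0 : ℝ) 1, DifferentiableAt ℝ g t)
    (hg₂ : ∀ t ∈ Ioo (0 : ℝ) 1, DifferentiableAt ℝ (deriv g) t)
    (hB₂ : ∀ t ∈ Ioo (0 : ℝ) 1, |deriv (deriv g) t| ≤ B₂) {s u : ℝ} (hs : s ∈ Ico (0 : ℝ) u)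
    (hu : u < 1) : |distDeriv g s - deriv g u| ≤ B₂ * |s - u| := by
  have hu' : u ∈ Ioo (0 : ℝ) 1 := ⟨hs.1.trans_lt hs.2, hu⟩
  have hinterior : ∀ t ∈ Ioo 0 u, |deriv g t - deriv g u| ≤ B₂ * |t - u| := fun t ht =>
    (convex_Ioo (0 : ℝ) 1).norm_image_sub_le_of_norm_deriv_le hg₂ hB₂ hu' ⟨ht.1, ht.2.trans hu⟩
  rcases hs.1.eq_or_lt with rfl | hs₀
  · have hB₂_nonneg : 0 ≤ B₂ := (abs_nonneg _).trans (hB₂ u hu')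
    refine closure_minimal (t := Metric.closedBall (deriv g u) (B₂ * |0 - u|)) ?_
      Metric.isClosed_closedBall (distDeriv_zero_mem_closure hg₀ hg₁ ⟨hu'.1, hu.le⟩)
    rintro _ ⟨t, ht, rfl⟩
    refine (hinterior t ht).trans (mul_le_mul_of_nonneg_left ?_ hB₂_nonneg)
    rw [abs_sub_comm, abs_sub_comm 0, abs_of_pos (sub_pos.2 ht.2), abs_of_pos (sub_pos.2 hu'.1)]
    linarith [ht.1]
  · rw [distDeriv_eq_deriv ⟨hs₀, hs.2.trans hu⟩]
    exact hinterior s ⟨hs₀, hs.2⟩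

theorem IsSmoothDistortion.of_abs_deriv_deriv_le
    (hg₀ : DifferentiableWithinAt ℝ g (Icc 0 1) 0)
    (hg₁ : ∀ t ∈ Ioo (0 : ℝ) 1, DifferentiableAt ℝ g t)
    (hg₂ : ∀ t ∈ Ioo (0 : ℝ) 1, DifferentiableAt ℝ (deriv g) t)
    (hB₁ : ∀ t ∈ Ioo (0 : ℝ) 1, |deriv g t| ≤ B₁)
    (hB₂ : ∀ t ∈ Ioo (0 : ℝ) 1, |deriv (deriv g) t| ≤ B₂) : IsSmoothDistortion g B₁ B₂ where
  differentiableWithinAt t ht := by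
    rcases ht.1.eq_or_lt with rfl | ht₀
    exacts [hg₀, (hg₁ t ⟨ht₀, ht.2⟩).differentiableWithinAt]
  abs_distDeriv_le t ht := by
    rcases ht.1.eq_or_lt with rfl | ht₀
    · refine abs_le.2 (closure_minimal (t := Icc (-B₁) B₁) ?_ isClosed_Icc
        (distDeriv_zero_mem_closure hg₀ hg₁ ⟨zero_lt_one, le_rfl⟩))
      rintro _ ⟨s, hs, rfl⟩
      exact abs_le.1 (hB₁ s hs)
    · rw [distDeriv_eq_deriv ⟨ht₀, ht.2⟩]
      exact hB₁ t ⟨ht₀, ht.2⟩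
  abs_distDeriv_sub_le s hs t ht := by
    wlog hst : s < t generalizing s t
    · rcases (not_lt.1 hst).eq_or_lt with rfl | hts
      · simp
      · rw [abs_sub_comm, abs_sub_comm s]
        exact this t ht s hs hts
    rw [distDeriv_eq_deriv ⟨hs.1.trans_lt hst, ht.2⟩]
    exact abs_distDeriv_sub_deriv_le hg₀ hg₁ hg₂ hB₂ ⟨hs.1, hst⟩ ht.2

end SecondDerivative

namespace IsSmoothDistortion

variable {g : ℝ → ℝ} {B₁ B₂ : ℝ} (hg : IsSmoothDistortion g B₁ B₂)

include hg

theorem bound_nonneg : 0 ≤ B₁ :=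
  (abs_nonneg _).trans (hg.abs_distDeriv_le 0 ⟨le_rfl, zero_lt_one⟩)

theorem lipschitz_nonneg : 0 ≤ B₂ := by
  have h := (abs_nonneg _).trans
    (hg.abs_distDeriv_sub_le (1 / 2) ⟨by norm_num, by norm_num⟩ 0 ⟨le_rfl, zero_lt_one⟩)
  exact nonneg_of_mul_nonneg_left h (by norm_num)

theorem hasDerivAt {t : ℝ} (ht : t ∈ Ioo (0 : ℝ) 1) : HasDerivAt g (distDeriv g t) t :=
  (hg.differentiableWithinAt t ⟨ht.1.le, ht.2⟩).hasDerivWithinAt.hasDerivAt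
    (Icc_mem_nhds ht.1 ht.2)

theorem bddAbove_image : BddAbove (g '' Icc 0 1) := by
  rw [← Ico_insert_right zero_le_one, image_insert_eq, bddAbove_insert]
  refine ⟨g 0 + B₁, ?_⟩
  rintro _ ⟨t, ht, rfl⟩
  have h := (convex_Ico (0 : ℝ) 1).norm_image_sub_le_of_norm_hasDerivWithin_le
    (fun s hs => (hg.differentiableWithinAt s hs).hasDerivWithinAt.mono Ico_subset_Icc_self)
    hg.abs_distDeriv_le ⟨le_rfl, zero_lt_one⟩ ht
  rw [sub_zero, Real.norm_of_nonneg ht.1] at h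
  linarith [(abs_le.1 h).2, mul_le_of_le_one_right hg.bound_nonneg ht.2.le]

variable {E : Type*} [NormedAddCommGroup E] [NormedSpace ℝ E]

-- At `p = 0` the derivative is taken at `1`, where it is not controlled, so `D` has to vanish.
theorem norm_distDeriv_smul_le {p : ℝ} (hp : p ∈ Icc (0 : ℝ) 1) {D : E} (hD : p = 0 → D = 0) :
    ‖distDeriv g (1 - p) • D‖ ≤ B₁ * ‖D‖ := by
  rcases hp.1.eq_or_lt with hp₀ | hp₀
  · simp [hD hp₀.symm]
  · rw [norm_smul]
    gcongr
    exact hg.abs_distDeriv_le _ ⟨by linarith [hp.2], by linarith⟩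

theorem norm_distDeriv_smul_sub_le {p q : ℝ} (hp : p ∈ Icc (0 : ℝ) 1)
    (hq : q ∈ Icc (0 : ℝ) 1) {D D' : E} (hD : p = 0 → D = 0) (hD' : q = 0 → D' = 0) :
    ‖distDeriv g (1 - p) • D - distDeriv g (1 - q) • D'‖ ≤
      B₁ * ‖D - D'‖ + B₂ * |p - q| * ‖D'‖ := by
  have hB₂ := hg.lipschitz_nonneg
  rcases hp.1.eq_or_lt with hp₀ | hp₀
  · rw [hD hp₀.symm, smul_zero, zero_sub, zero_sub, norm_neg, norm_neg]
    exact le_add_of_le_of_nonneg (hg.norm_distDeriv_smul_le hq hD') (by positivity)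
  rcases hq.1.eq_or_lt with hq₀ | hq₀
  · rw [hD' hq₀.symm, smul_zero, sub_zero, sub_zero]
    exact le_add_of_le_of_nonneg (hg.norm_distDeriv_smul_le hp hD) (by positivity)
  have hp' : 1 - p ∈ Ico (0 : ℝ) 1 := ⟨by linarith [hp.2], by linarith⟩
  have hq' : 1 - q ∈ Ico (0 : ℝ) 1 := ⟨by linarith [hq.2], by linarith⟩
  have hlip := hg.abs_distDeriv_sub_le _ hp' _ hq'
  rw [sub_sub_sub_cancel_left, abs_sub_comm q] at hlip
  calc ‖distDeriv g (1 - p) • D - distDeriv g (1 - q) • D'‖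
      = ‖distDeriv g (1 - p) • (D - D') + (distDeriv g (1 - p) - distDeriv g (1 - q)) • D'‖ := by
        rw [smul_sub, sub_smul, sub_add_sub_cancel]
    _ ≤ |distDeriv g (1 - p)| * ‖D - D'‖ + |distDeriv g (1 - p) - distDeriv g (1 - q)| * ‖D'‖ := by
        simpa only [norm_smul, Real.norm_eq_abs] using norm_add_le (distDeriv g (1 - p) • (D - D'))
          ((distDeriv g (1 - p) - distDeriv g (1 - q)) • D')
    _ ≤ _ := by
        gcongr
        exact hg.abs_distDeriv_le _ hp'

end IsSmoothDistortion

section GradientAscent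

variable {E : Type*} [NormedAddCommGroup E] [InnerProductSpace ℝ E] [CompleteSpace E]
  {f : E → ℝ} {f' : E → E} {K : ℝ}

theorem hasDerivAt_comp_line {x : E} {y v : E} {t : ℝ} (hf : HasGradientAt f y (x + t • v)) :
    HasDerivAt (fun s : ℝ => f (x + s • v)) ⟪y, v⟫_ℝ t := by
  have hline : HasDerivAt (fun s : ℝ => x + s • v) v t := by
    simpa using ((hasDerivAt_id t).smul_const v).const_add x
  simpa [Function.comp_def] using hf.hasFDerivAt.comp_hasDerivAt t hline

theorem quadratic_le_of_lipschitz_gradient (hf : ∀ x, HasGradientAt f (f' x) x)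
    (hK : ∀ x y, ‖f' x - f' y‖ ≤ K * ‖x - y‖) (x v : E) :
    f x + ⟪f' x, v⟫_ℝ - K / 2 * ‖v‖ ^ 2 ≤ f (x + v) := by
  let φ : ℝ → ℝ := fun t => f (x + t • v) - t * ⟪f' x, v⟫_ℝ + K / 2 * ‖v‖ ^ 2 * t ^ 2
  have hφ : ∀ t, HasDerivAt φ (⟪f' (x + t • v) - f' x, v⟫_ℝ + K * ‖v‖ ^ 2 * t) t := fun t => by
    refine (((hasDerivAt_comp_line (hf _)).sub ((hasDerivAt_id t).mul_const ⟪f' x, v⟫_ℝ)).add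
      ((hasDerivAt_pow 2 t).const_mul (K / 2 * ‖v‖ ^ 2))).congr_deriv ?_
    rw [inner_sub_left]
    push_cast
    ring
  have hφ'_nonneg : ∀ t, 0 ≤ t → 0 ≤ ⟪f' (x + t • v) - f' x, v⟫_ℝ + K * ‖v‖ ^ 2 * t :=
    fun t ht => by
      have hcauchy := abs_le.1 (abs_real_inner_le_norm (f' (x + t • v) - f' x) v)
      have hlip := hK (x + t • v) x
      rw [add_sub_cancel_left, norm_smul, Real.norm_of_nonneg ht] at hlip
      linarith [mul_le_mul_of_nonneg_right hlip (norm_nonneg v), hcauchy.1]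
  have hmono : MonotoneOn φ (Ici 0) :=
    monotoneOn_of_hasDerivWithinAt_nonneg (convex_Ici 0)
      (fun t _ => (hφ t).continuousAt.continuousWithinAt)
      (fun t _ => (hφ t).hasDerivWithinAt)
      fun t ht => hφ'_nonneg t (interior_subset ht)
  have h01 : φ 0 ≤ φ 1 := hmono self_mem_Ici (mem_Ici.2 zero_le_one) zero_le_one
  simp only [φ, zero_smul, one_smul, add_zero, zero_mul, one_mul, one_pow] at h01
  linarith

theorem gradient_step_ascent (hf : ∀ x, HasGradientAt f (f' x) x)
    (hK : ∀ x y, ‖f' x - f' y‖ ≤ K * ‖x - y‖) {α : ℝ} (hα : 0 ≤ α) (hαK : α * K ≤ 1) (x h : E) :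
    f x + α / 2 * ‖f' x‖ ^ 2 - α / 2 * ‖h - f' x‖ ^ 2 ≤ f (x + α • h) := by
  have hquad := quadratic_le_of_lipschitz_gradient hf hK x (α • h)
  rw [real_inner_smul_right, norm_smul, Real.norm_of_nonneg hα] at hquad
  have hslack : 0 ≤ α * (1 - α * K) * ‖h‖ ^ 2 :=
    mul_nonneg (mul_nonneg hα (sub_nonneg.2 hαK)) (sq_nonneg _)
  rw [norm_sub_sq_real, real_inner_comm]
  linarith

end GradientAscent

/-- The expectation of `F` under the discrete law `p`. -/
noncomputable def pmfMean {α : Type*} (p : PMF α) (F : α → ℝ≥0∞) : ℝ≥0∞ := ∑' a, p a * F a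

section PMFMean

variable {α β : Type*}

theorem pmfMean_const (p : PMF α) (c : ℝ≥0∞) : pmfMean p (fun _ => c) = c := by
  rw [pmfMean, ENNReal.tsum_mul_right, p.tsum_coe, one_mul]

theorem pmfMean_add (p : PMF α) (F G : α → ℝ≥0∞) :
    pmfMean p (fun a => F a + G a) = pmfMean p F + pmfMean p G := by
  simp only [pmfMean, mul_add, ENNReal.tsum_add]

theorem pmfMean_mono (p : PMF α) {F G : α → ℝ≥0∞} (h : ∀ a, F a ≤ G a) :
    pmfMean p F ≤ pmfMean p G :=
  ENNReal.tsum_le_tsum fun a => by gcongr; exact h a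

theorem pmfMean_pure (a : α) (F : α → ℝ≥0∞) : pmfMean (PMF.pure a) F = F a := by
  rw [pmfMean, tsum_eq_single a fun b hb => by simp [PMF.pure_apply_of_ne _ _ hb]]
  simp

theorem pmfMean_bind (p : PMF α) (κ : α → PMF β) (F : β → ℝ≥0∞) :
    pmfMean (p.bind κ) F = pmfMean p fun a => pmfMean (κ a) F := by
  simp_rw [pmfMean, PMF.bind_apply, ← ENNReal.tsum_mul_right, ← ENNReal.tsum_mul_left, ← mul_assoc]
  exact ENNReal.tsum_comm

theorem pmfMean_map (p : PMF α) (f : α → β) (F : β → ℝ≥0∞) :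
    pmfMean (p.map f) F = pmfMean p fun a => F (f a) := by
  rw [PMF.map, pmfMean_bind]
  simp_rw [Function.comp_apply, pmfMean_pure]

theorem pmfMean_uniformOfFinset {s : Finset α} (hs : s.Nonempty) (F : α → ℝ≥0∞) :
    pmfMean (PMF.uniformOfFinset s hs) F = (s.card : ℝ≥0∞)⁻¹ * ∑ a ∈ s, F a := by
  rw [pmfMean, tsum_eq_sum (s := s) fun a ha => by
    rw [PMF.uniformOfFinset_apply_of_notMem _ ha, zero_mul], Finset.mul_sum]
  exact Finset.sum_congr rfl fun a ha => by rw [PMF.uniformOfFinset_apply_of_mem _ ha]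

theorem sum_pmfMean_le_of_drift {μ : ℕ → PMF α} {κ : α → PMF α}
    (hμ : ∀ k, μ (k + 1) = (μ k).bind κ) {V G : α → ℝ≥0∞} {δ : ℝ≥0∞}
    (hdrift : ∀ a, pmfMean (κ a) V + G a ≤ V a + δ) (n : ℕ) :
    pmfMean (μ n) V + ∑ k ∈ Finset.range n, pmfMean (μ k) G ≤ pmfMean (μ 0) V + n * δ := by
  have hstep : ∀ k, pmfMean (μ (k + 1)) V + pmfMean (μ k) G ≤ pmfMean (μ k) V + δ := fun k => by
    rw [hμ, pmfMean_bind, ← pmfMean_add, ← pmfMean_const (μ k) δ, ← pmfMean_add]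
    exact pmfMean_mono _ hdrift
  induction n with
  | zero => simp
  | succ n ih =>
    calc pmfMean (μ (n + 1)) V + ∑ k ∈ Finset.range (n + 1), pmfMean (μ k) G
        = (pmfMean (μ (n + 1)) V + pmfMean (μ n) G) + ∑ k ∈ Finset.range n, pmfMean (μ k) G := by
          rw [Finset.sum_range_succ]; ring
      _ ≤ (pmfMean (μ n) V + δ) + ∑ k ∈ Finset.range n, pmfMean (μ k) G :=
          add_le_add_left (hstep n) _
      _ = (pmfMean (μ n) V + ∑ k ∈ Finset.range n, pmfMean (μ k) G) + δ := by ring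
      _ ≤ (pmfMean (μ 0) V + n * δ) + δ := by gcongr
      _ = pmfMean (μ 0) V + (n + 1 : ℕ) * δ := by push_cast; ring

end PMFMean

section StochasticGradientAscent

variable {E Ω : Type*} [NormedAddCommGroup E] [InnerProductSpace ℝ E] [CompleteSpace E]
  {f : E → ℝ} {f' : E → E} {K α c : ℝ} {h : E → Ω → E} {q : E → PMF Ω} {δ : ℝ≥0∞}

theorem pmfMean_gap_step_le (hf : ∀ x, HasGradientAt f (f' x) x)
    (hK : ∀ x y, ‖f' x - f' y‖ ≤ K * ‖x - y‖) (hα : 0 < α) (hαK : α * K ≤ 1) (hc : ∀ x, f x ≤ c)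
    {x : E} {p : PMF Ω} {h : Ω → E}
    (hδ : pmfMean p (fun ω => ENNReal.ofReal (‖h ω - f' x‖ ^ 2)) ≤ δ) :
    pmfMean p (fun ω => ENNReal.ofReal (2 / α * (c - f (x + α • h ω)))) +
        ENNReal.ofReal (‖f' x‖ ^ 2) ≤
      ENNReal.ofReal (2 / α * (c - f x)) + δ := by
  have hpointwise : ∀ ω, ENNReal.ofReal (2 / α * (c - f (x + α • h ω))) +
      ENNReal.ofReal (‖f' x‖ ^ 2) ≤
        ENNReal.ofReal (2 / α * (c - f x)) + ENNReal.ofReal (‖h ω - f' x‖ ^ 2) := fun ω => by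
    have hgap : ∀ y, 0 ≤ 2 / α * (c - f y) := fun y =>
      mul_nonneg (by positivity) (sub_nonneg.2 (hc y))
    rw [← ENNReal.ofReal_add (hgap _) (sq_nonneg _), ← ENNReal.ofReal_add (hgap _) (sq_nonneg _)]
    refine ENNReal.ofReal_le_ofReal ?_
    have hascent := mul_le_mul_of_nonneg_left (gradient_step_ascent hf hK hα.le hαK x (h ω))
      (by positivity : 0 ≤ 2 / α)
    have hcancel : ∀ r, 2 / α * (α / 2 * r) = r := fun r => by field_simp
    rw [mul_sub, mul_add, hcancel, hcancel] at hascent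
    linarith
  calc _ = pmfMean p fun ω => ENNReal.ofReal (2 / α * (c - f (x + α • h ω))) +
        ENNReal.ofReal (‖f' x‖ ^ 2) := by rw [pmfMean_add, pmfMean_const]
    _ ≤ pmfMean p fun ω =>
        ENNReal.ofReal (2 / α * (c - f x)) + ENNReal.ofReal (‖h ω - f' x‖ ^ 2) :=
      pmfMean_mono p hpointwise
    _ ≤ _ := by rw [pmfMean_add, pmfMean_const]; gcongr

theorem sum_pmfMean_sq_norm_gradient_le (hf : ∀ x, HasGradientAt f (f' x) x)
    (hK : ∀ x y, ‖f' x - f' y‖ ≤ K * ‖x - y‖) (hα : 0 < α) (hαK : α * K ≤ 1) (hc : ∀ x, f x ≤ c)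
    (hδ : ∀ x, pmfMean (q x) (fun ω => ENNReal.ofReal (‖h x ω - f' x‖ ^ 2)) ≤ δ)
    {μ : ℕ → PMF E} {x₀ : E} (hμ₀ : μ 0 = PMF.pure x₀)
    (hμ : ∀ k, μ (k + 1) = (μ k).bind fun x => (q x).map fun ω => x + α • h x ω) (n : ℕ) :
    ∑ k ∈ Finset.range n, pmfMean (μ k) (fun x => ENNReal.ofReal (‖f' x‖ ^ 2)) ≤
      ENNReal.ofReal (2 / α * (c - f x₀)) + n * δ := by
  have hdrift := sum_pmfMean_le_of_drift hμ (δ := δ)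
    (V := fun x => ENNReal.ofReal (2 / α * (c - f x)))
    (G := fun x => ENNReal.ofReal (‖f' x‖ ^ 2))
    (fun x => by rw [pmfMean_map]; exact pmfMean_gap_step_le hf hK hα hαK hc (hδ x)) n
  rw [hμ₀, pmfMean_pure] at hdrift
  exact le_add_self.trans hdrift

theorem pmfMean_uniform_iterate_sq_norm_gradient_le (hf : ∀ x, HasGradientAt f (f' x) x)
    (hK : ∀ x y, ‖f' x - f' y‖ ≤ K * ‖x - y‖) (hα : 0 < α) (hαK : α * K ≤ 1) (hc : ∀ x, f x ≤ c)
    {σ : ℝ} (hσ : 0 ≤ σ)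
    (hmse : ∀ x, pmfMean (q x) (fun ω => ENNReal.ofReal (‖h x ω - f' x‖ ^ 2)) ≤ ENNReal.ofReal σ)
    {μ : ℕ → PMF E} {x₀ : E} (hμ₀ : μ 0 = PMF.pure x₀)
    (hμ : ∀ k, μ (k + 1) = (μ k).bind fun x => (q x).map fun ω => x + α • h x ω)
    {N : ℕ} (hN : (Finset.Icc 1 N).Nonempty) :
    pmfMean ((PMF.uniformOfFinset (Finset.Icc 1 N) hN).bind μ)
        (fun x => ENNReal.ofReal (‖f' x‖ ^ 2)) ≤
      ENNReal.ofReal ((2 / α * (c - f x₀) + (N + 1) * σ) / N) := by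
  have hN₀ : 0 < N := Finset.nonempty_Icc.1 hN
  have hgap : 0 ≤ 2 / α * (c - f x₀) := mul_nonneg (by positivity) (sub_nonneg.2 (hc x₀))
  rw [pmfMean_bind, pmfMean_uniformOfFinset, Nat.card_Icc, Nat.add_sub_cancel, mul_comm,
    ← div_eq_mul_inv, ENNReal.ofReal_div_of_pos (by positivity), ENNReal.ofReal_natCast]
  gcongr
  calc _ ≤ ∑ k ∈ Finset.range (N + 1), pmfMean (μ k) fun x => ENNReal.ofReal (‖f' x‖ ^ 2) :=
        Finset.sum_le_sum_of_subset fun k hk =>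
          Finset.mem_range.2 (Nat.lt_succ_of_le (Finset.mem_Icc.1 hk).2)
    _ ≤ ENNReal.ofReal (2 / α * (c - f x₀)) + (N + 1 : ℕ) * ENNReal.ofReal σ :=
        sum_pmfMean_sq_norm_gradient_le hf hK hα hαK hc hmse hμ₀ hμ (N + 1)
    _ = _ := by
        rw [ENNReal.ofReal_add hgap (by positivity),
          ENNReal.ofReal_mul (p := (N : ℝ) + 1) (by positivity), ← Nat.cast_add_one,
          ENNReal.ofReal_natCast]

end StochasticGradientAscent

/-- The expectation of `f` over `m` independent draws from the finitely many weights `p`. Unlike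
`pmfMean` it is real-valued, as the cancellation of cross terms in a variance requires. -/
def iidExpectation {Ω : Type*} [Fintype Ω] (p : Ω → ℝ) (m : ℕ) (f : (Fin m → Ω) → ℝ) : ℝ :=
  ∑ v, (∏ i, p (v i)) * f v

section IIDExpectation

variable {Ω : Type*} [Fintype Ω] {p : Ω → ℝ} {m : ℕ}

theorem iidExpectation_succ (p : Ω → ℝ) (m : ℕ) (f : (Fin (m + 1) → Ω) → ℝ) :
    iidExpectation p (m + 1) f =
      ∑ a, p a * iidExpectation p m fun v => f (Fin.cons a v) := by
  unfold iidExpectation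
  rw [← (Fin.consEquiv fun _ : Fin (m + 1) => Ω).sum_comp, Fintype.sum_prod_type]
  simp only [Fin.consEquiv_apply, Fin.prod_univ_succ, Finset.mul_sum, mul_assoc, Fin.cons_zero,
    Fin.cons_succ]
  rfl

theorem iidExpectation_add (p : Ω → ℝ) (m : ℕ) (f h : (Fin m → Ω) → ℝ) :
    iidExpectation p m (fun v => f v + h v) = iidExpectation p m f + iidExpectation p m h := by
  simp only [iidExpectation, mul_add, Finset.sum_add_distrib]

theorem iidExpectation_const_mul (p : Ω → ℝ) (m : ℕ) (c : ℝ) (f : (Fin m → Ω) → ℝ) :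
    iidExpectation p m (fun v => c * f v) = c * iidExpectation p m f := by
  simp only [iidExpectation, Finset.mul_sum, mul_left_comm]

theorem iidExpectation_sum {ι : Type*} (s : Finset ι) (p : Ω → ℝ) (m : ℕ)
    (f : ι → (Fin m → Ω) → ℝ) :
    iidExpectation p m (fun v => ∑ j ∈ s, f j v) = ∑ j ∈ s, iidExpectation p m (f j) := by
  simp only [iidExpectation, Finset.mul_sum]
  exact Finset.sum_comm

theorem iidExpectation_const (hp : ∑ a, p a = 1) (m : ℕ) (c : ℝ) :
    iidExpectation p m (fun _ => c) = c := by
  induction m with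
  | zero => simp [iidExpectation]
  | succ m ih => rw [iidExpectation_succ, ih, ← Finset.sum_mul, hp, one_mul]

theorem iidExpectation_mono (hp₀ : ∀ a, 0 ≤ p a) {f h : (Fin m → Ω) → ℝ}
    (hfh : ∀ v, f v ≤ h v) : iidExpectation p m f ≤ iidExpectation p m h :=
  Finset.sum_le_sum fun v _ =>
    mul_le_mul_of_nonneg_left (hfh v) (Finset.prod_nonneg fun i _ => hp₀ (v i))

variable {E : Type*} [NormedAddCommGroup E] [InnerProductSpace ℝ E]

theorem sum_mul_inner (p : Ω → ℝ) (Y : Ω → E) (x : E) :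
    ∑ a, p a * ⟪Y a, x⟫_ℝ = ⟪∑ a, p a • Y a, x⟫_ℝ := by
  simp only [sum_inner, real_inner_smul_left]

theorem iidExpectation_sq_norm_sum (hp : ∑ a, p a = 1) {Y : Ω → E}
    (hY : ∑ a, p a • Y a = 0) (m : ℕ) :
    iidExpectation p m (fun v => ‖∑ i, Y (v i)‖ ^ 2) = m * ∑ a, p a * ‖Y a‖ ^ 2 := by
  induction m with
  | zero => simp [iidExpectation]
  | succ m ih =>
    have hcross : ∑ a, p a * iidExpectation p m (fun v => 2 * ⟪Y a, ∑ i, Y (v i)⟫_ℝ) = 0 := by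
      simp_rw [← iidExpectation_const_mul, ← iidExpectation_sum, mul_left_comm _ (2 : ℝ),
        ← Finset.mul_sum, sum_mul_inner, hY, inner_zero_left, mul_zero, iidExpectation_const hp]
    simp_rw [iidExpectation_succ, Fin.sum_univ_succ, Fin.cons_zero, Fin.cons_succ,
      norm_add_sq_real, iidExpectation_add, mul_add, Finset.sum_add_distrib, hcross, ih,
      iidExpectation_const hp, ← Finset.sum_mul, hp]
    push_cast
    ring

theorem sum_mul_sq_norm_sub_mean_le (hp₀ : ∀ a, 0 ≤ p a) (hp : ∑ a, p a = 1) {X : Ω → E} {K : ℝ}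
    (hX : ∀ a, ‖X a‖ ≤ K) : ∑ a, p a * ‖X a - ∑ b, p b • X b‖ ^ 2 ≤ K ^ 2 := by
  set μ : E := ∑ b, p b • X b with hμ
  have hvariance : ∑ a, p a * ‖X a - μ‖ ^ 2 = ∑ a, p a * ‖X a‖ ^ 2 - ‖μ‖ ^ 2 := by
    simp_rw [norm_sub_sq_real, mul_add, mul_sub, Finset.sum_add_distrib, Finset.sum_sub_distrib,
      ← Finset.sum_mul, hp, mul_left_comm _ (2 : ℝ), ← Finset.mul_sum, sum_mul_inner, ← hμ,
      real_inner_self_eq_norm_sq]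
    ring
  have hsecond : ∑ a, p a * ‖X a‖ ^ 2 ≤ ∑ a, p a * K ^ 2 := Finset.sum_le_sum fun a _ =>
    mul_le_mul_of_nonneg_left (pow_le_pow_left₀ (norm_nonneg _) (hX a) 2) (hp₀ a)
  rw [← Finset.sum_mul, hp, one_mul] at hsecond
  linarith [sq_nonneg ‖μ‖]

theorem iidExpectation_sq_norm_mean_sub_le (hp₀ : ∀ a, 0 ≤ p a) (hp : ∑ a, p a = 1) {X : Ω → E}
    {K : ℝ} (hX : ∀ a, ‖X a‖ ≤ K) (hm : m ≠ 0) :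
    iidExpectation p m (fun v => ‖(m : ℝ)⁻¹ • ∑ i, X (v i) - ∑ a, p a • X a‖ ^ 2) ≤
      K ^ 2 / m := by
  set μ : E := ∑ a, p a • X a
  have hcentered : ∑ a, p a • (X a - μ) = 0 := by
    simp_rw [smul_sub, Finset.sum_sub_distrib, ← Finset.sum_smul, hp, one_smul]
    exact sub_self _
  have hdeviation : ∀ v : Fin m → Ω, ‖(m : ℝ)⁻¹ • ∑ i, X (v i) - μ‖ ^ 2 =
      ((m : ℝ) ^ 2)⁻¹ * ‖∑ i, (X (v i) - μ)‖ ^ 2 := fun v => by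
    have hmean : (m : ℝ)⁻¹ • ∑ i, X (v i) - μ = (m : ℝ)⁻¹ • ∑ i, (X (v i) - μ) := by
      simp [smul_sub, ← Nat.cast_smul_eq_nsmul ℝ, smul_smul, hm]
    rw [hmean, norm_smul, mul_pow, norm_inv, RCLike.norm_natCast, inv_pow]
  simp_rw [hdeviation, iidExpectation_const_mul, iidExpectation_sq_norm_sum hp hcentered]
  calc _ = (∑ a, p a * ‖X a - μ‖ ^ 2) / m := by field_simp
    _ ≤ K ^ 2 / m := by gcongr; exact sum_mul_sq_norm_sub_mean_le hp₀ hp hX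

theorem pmfMean_iidLaw {α : Type*} {q : PMF α} {s : Set α} [Fintype s] (hs : q.support ⊆ s)
    {F : (Fin m → α) → ℝ} (hF : ∀ w, 0 ≤ F w) :
    pmfMean (iidLaw q m) (fun w => ENNReal.ofReal (F w)) =
      ENNReal.ofReal (iidExpectation (fun a : s => (q a).toReal) m fun v => F fun i => v i) := by
  have hlaw : ∀ w, iidLaw q m w = ∏ i, q (w i) := fun w => rfl
  have hinjective : Function.Injective fun (v : Fin m → s) (i : Fin m) => (v i : α) :=
    Subtype.val_injective.comp_left
  have hprod : ∀ v : Fin m → s, 0 ≤ ∏ i, (q (v i)).toReal := fun v =>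
    Finset.prod_nonneg fun i _ => ENNReal.toReal_nonneg
  rw [pmfMean, ← hinjective.tsum_eq, tsum_fintype, iidExpectation,
    ENNReal.ofReal_sum_of_nonneg fun v _ => mul_nonneg (hprod v) (hF _)]
  · refine Finset.sum_congr rfl fun v _ => ?_
    rw [ENNReal.ofReal_mul (hprod v),
      ENNReal.ofReal_prod_of_nonneg fun i _ => ENNReal.toReal_nonneg, hlaw]
    simp only [ENNReal.ofReal_toReal (q.apply_ne_top _)]
  · intro w hw
    have hmem : ∀ i, w i ∈ s := fun i => hs <| by
      rw [Function.mem_support, hlaw] at hw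
      exact Finset.prod_ne_zero_iff.1 (left_ne_zero_of_mul hw) i (Finset.mem_univ i)
    exact ⟨fun i => ⟨w i, hmem i⟩, rfl⟩

end IIDExpectation

theorem sq_norm_sum_smul_le {ι F : Type*} [Fintype ι] [SeminormedAddCommGroup F] [NormedSpace ℝ F]
    {w : ι → ℝ} (hw : ∀ i, 0 ≤ w i) (x : ι → F) :
    ‖∑ i, w i • x i‖ ^ 2 ≤ (∑ i, w i) * ∑ i, w i * ‖x i‖ ^ 2 := by
  have htriangle : ‖∑ i, w i • x i‖ ≤ ∑ i, w i * ‖x i‖ := norm_sum_le_of_le _ fun i _ => by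
    rw [norm_smul, Real.norm_of_nonneg (hw i)]
  refine (pow_le_pow_left₀ (norm_nonneg _) htriangle 2).trans ?_
  exact Finset.sum_sq_le_sum_mul_sum_of_sq_le_mul _ (fun i _ => hw i)
    (fun i _ => mul_nonneg (hw i) (sq_nonneg _)) fun i _ => by rw [mul_pow, sq, mul_assoc]

/-- A parametrized family of positive probability weights on a finite set whose log-likelihoods
are twice differentiable, with gradient (the score) bounded by `K₁` and Hessian by `K₂`. Episodes
under `π_θ` form such a family; only its likelihood-ratio structure matters for the estimates. -/
structure LikelihoodModel (E Ω : Type*) [NormedAddCommGroup E] [InnerProductSpace ℝ E]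
    [CompleteSpace E] [Fintype Ω] (K₁ K₂ : ℝ) where
  prob : E → Ω → ℝ
  score : Ω → E → E
  prob_pos : ∀ θ ω, 0 < prob θ ω
  sum_prob : ∀ θ, ∑ ω, prob θ ω = 1
  hasGradientAt : ∀ θ ω, HasGradientAt (fun θ => prob θ ω) (prob θ ω • score ω θ) θ
  differentiable_score : ∀ ω, Differentiable ℝ (score ω)
  norm_score_le : ∀ ω θ, ‖score ω θ‖ ≤ K₁
  norm_fderiv_score_le : ∀ ω θ, ‖fderiv ℝ (score ω) θ‖ ≤ K₂

namespace LikelihoodModel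

variable {E Ω : Type*} [NormedAddCommGroup E] [InnerProductSpace ℝ E] [CompleteSpace E]
  [Fintype Ω] {K₁ K₂ : ℝ} (P : LikelihoodModel E Ω K₁ K₂)

include P in
theorem nonempty_outcomes : Nonempty Ω := by
  by_contra h
  rw [not_nonempty_iff] at h
  simpa using P.sum_prob 0

include P in
theorem score_bound_nonneg : 0 ≤ K₁ :=
  have ⟨ω⟩ := P.nonempty_outcomes
  (norm_nonneg _).trans (P.norm_score_le ω 0)

include P in
theorem hessian_bound_nonneg : 0 ≤ K₂ :=
  have ⟨ω⟩ := P.nonempty_outcomes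
  (norm_nonneg _).trans (P.norm_fderiv_score_le ω 0)

/-- The probability of the event `U`. -/
def eventProb (U : Finset Ω) (θ : E) : ℝ := ∑ ω ∈ U, P.prob θ ω

/-- The gradient of the probability of the event `U`, in likelihood-ratio form. -/
def eventGrad (U : Finset Ω) (θ : E) : E := ∑ ω ∈ U, P.prob θ ω • P.score ω θ

theorem eventProb_univ (θ : E) : P.eventProb Finset.univ θ = 1 := P.sum_prob θ

theorem eventProb_pos {U : Finset Ω} (hU : U.Nonempty) (θ : E) : 0 < P.eventProb U θ :=
  Finset.sum_pos (fun ω _ => P.prob_pos θ ω) hU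

theorem eventProb_lt_one {U : Finset Ω} (hU : U ≠ Finset.univ) (θ : E) : P.eventProb U θ < 1 := by
  obtain ⟨ω, hω⟩ : ∃ ω, ω ∉ U := by
    simpa only [ne_eq, Finset.eq_univ_iff_forall, not_forall] using hU
  exact P.sum_prob θ ▸ Finset.sum_lt_sum_of_subset (Finset.subset_univ U) (Finset.mem_univ ω) hω
    (P.prob_pos θ ω) fun ω _ _ => (P.prob_pos θ ω).le

theorem eventProb_mem_Icc (U : Finset Ω) (θ : E) : P.eventProb U θ ∈ Icc (0 : ℝ) 1 :=
  ⟨Finset.sum_nonneg fun ω _ => (P.prob_pos θ ω).le,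
    P.sum_prob θ ▸ Finset.sum_le_sum_of_subset_of_nonneg (Finset.subset_univ U)
      fun ω _ _ => (P.prob_pos θ ω).le⟩

theorem hasGradientAt_eventProb (U : Finset Ω) (θ : E) :
    HasGradientAt (P.eventProb U) (P.eventGrad U θ) θ := by
  rw [hasGradientAt_iff_hasFDerivAt, eventGrad, map_sum]
  exact HasFDerivAt.fun_sum fun ω _ => (P.hasGradientAt θ ω).hasFDerivAt

theorem eventGrad_univ (θ : E) : P.eventGrad Finset.univ θ = 0 := by
  have hconst : P.eventProb Finset.univ = fun _ => 1 := funext P.eventProb_univ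
  exact (P.hasGradientAt_eventProb Finset.univ θ).unique (hconst ▸ hasGradientAt_const θ 1)

theorem eventGrad_eq_zero {U : Finset Ω} {θ : E} (h : P.eventProb U θ = 0) :
    P.eventGrad U θ = 0 := by
  rcases U.eq_empty_or_nonempty with rfl | hU
  · exact Finset.sum_empty
  · exact absurd h (P.eventProb_pos hU θ).ne'

theorem norm_sum_prob_smul_le {F : Type*} [SeminormedAddCommGroup F] [NormedSpace ℝ F] {K : ℝ}
    (hK : 0 ≤ K) (U : Finset Ω) (θ : E) {X : Ω → F} (hX : ∀ ω, ‖X ω‖ ≤ K) :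
    ‖∑ ω ∈ U, P.prob θ ω • X ω‖ ≤ K := by
  calc _ ≤ ∑ ω ∈ U, P.prob θ ω * K := norm_sum_le_of_le _ fun ω _ => by
        rw [norm_smul, Real.norm_of_nonneg (P.prob_pos θ ω).le]
        exact mul_le_mul_of_nonneg_left (hX ω) (P.prob_pos θ ω).le
    _ = P.eventProb U θ * K := (Finset.sum_mul ..).symm
    _ ≤ K := mul_le_of_le_one_left hK (P.eventProb_mem_Icc U θ).2

theorem norm_eventGrad_le (U : Finset Ω) (θ : E) : ‖P.eventGrad U θ‖ ≤ K₁ :=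
  P.norm_sum_prob_smul_le P.score_bound_nonneg U θ fun ω => P.norm_score_le ω θ

theorem abs_eventProb_sub_le (U : Finset Ω) (θ η : E) :
    |P.eventProb U θ - P.eventProb U η| ≤ K₁ * ‖θ - η‖ := by
  refine convex_univ.norm_image_sub_le_of_norm_hasFDerivWithin_le
    (fun x _ => (P.hasGradientAt_eventProb U x).hasFDerivAt.hasFDerivWithinAt) (fun x _ => ?_)
    (mem_univ η) (mem_univ θ)
  rw [LinearIsometryEquiv.norm_map]
  exact P.norm_eventGrad_le U x

/-- The ratio `∇²p / p = ∇² log p + ∇ log p ⊗ ∇ log p` of the Hessian of the probability `p` of an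
outcome to `p` itself. -/
noncomputable def hessianRatio (ω : Ω) (θ : E) : E →L[ℝ] E :=
  fderiv ℝ (P.score ω) θ +
    (InnerProductSpace.toDual ℝ E (P.score ω θ)).smulRight (P.score ω θ)

theorem hasFDerivAt_eventGrad (U : Finset Ω) (θ : E) :
    HasFDerivAt (P.eventGrad U) (∑ ω ∈ U, P.prob θ ω • P.hessianRatio ω θ) θ := by
  refine HasFDerivAt.fun_sum fun ω _ => ?_
  refine ((P.hasGradientAt θ ω).hasFDerivAt.fun_smul
    (P.differentiable_score ω θ).hasFDerivAt).congr_fderiv ?_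
  ext v
  simp [hessianRatio, smul_smul]

theorem norm_hessianRatio_le (ω : Ω) (θ : E) : ‖P.hessianRatio ω θ‖ ≤ K₂ + K₁ ^ 2 := by
  refine (norm_add_le _ _).trans (add_le_add (P.norm_fderiv_score_le ω θ) ?_)
  rw [ContinuousLinearMap.norm_smulRight_apply, LinearIsometryEquiv.norm_map, ← sq]
  exact pow_le_pow_left₀ (norm_nonneg _) (P.norm_score_le ω θ) 2

theorem norm_eventGrad_sub_le (U : Finset Ω) (θ η : E) :
    ‖P.eventGrad U θ - P.eventGrad U η‖ ≤ (K₂ + K₁ ^ 2) * ‖θ - η‖ :=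
  convex_univ.norm_image_sub_le_of_norm_hasFDerivWithin_le
    (fun x _ => (P.hasFDerivAt_eventGrad U x).hasFDerivWithinAt)
    (fun x _ => P.norm_sum_prob_smul_le (add_nonneg P.hessian_bound_nonneg (sq_nonneg K₁)) U x
      fun ω => P.norm_hessianRatio_le ω x) (mem_univ η) (mem_univ θ)

theorem hasGradientAt_distortion {g : ℝ → ℝ} {B₁ B₂ : ℝ} (hg : IsSmoothDistortion g B₁ B₂)
    (U : Finset Ω) (θ : E) : HasGradientAt (fun θ => g (1 - P.eventProb U θ))
      (-(distDeriv g (1 - P.eventProb U θ) • P.eventGrad U θ)) θ := by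
  -- The probabilities `0` and `1`, where `g` is not differentiable, only occur for constant events.
  rcases U.eq_empty_or_nonempty with rfl | hU
  · simpa [eventGrad, eventProb] using hasGradientAt_const θ (g 1)
  by_cases hU' : U = Finset.univ
  · subst hU'
    simp only [eventProb_univ, eventGrad_univ, smul_zero, neg_zero]
    exact hasGradientAt_const θ _
  have hinterior : 1 - P.eventProb U θ ∈ Ioo (0 : ℝ) 1 :=
    ⟨by linarith [P.eventProb_lt_one hU' θ], by linarith [P.eventProb_pos hU θ]⟩
  rw [hasGradientAt_iff_hasFDerivAt]
  refine ((hg.hasDerivAt hinterior).comp_hasFDerivAt θ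
    ((P.hasGradientAt_eventProb U θ).hasFDerivAt.const_sub 1)).congr_fderiv ?_
  ext v
  simp

section Risk

variable (g : ℝ → ℝ) (w : Finset Ω → ℝ)

/-- A weighted sum of distorted event probabilities, the finite form of a distortion risk measure:
the weight of `U` is the length of the set of levels whose sublevel event is `U`. -/
noncomputable def risk (θ : E) : ℝ := ∑ U, w U * g (1 - P.eventProb U θ)

/-- The gradient of `LikelihoodModel.risk`, in likelihood-ratio form. -/
noncomputable def riskGrad (θ : E) : E :=
  -∑ U, w U • distDeriv g (1 - P.eventProb U θ) • P.eventGrad U θ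

variable {g w} {B₁ B₂ : ℝ}

theorem hasGradientAt_risk (hg : IsSmoothDistortion g B₁ B₂) (θ : E) :
    HasGradientAt (P.risk g w) (P.riskGrad g w θ) θ := by
  rw [hasGradientAt_iff_hasFDerivAt]
  refine (HasFDerivAt.fun_sum (u := Finset.univ) fun (U : Finset Ω) _ =>
    (P.hasGradientAt_distortion hg U θ).hasFDerivAt.const_mul (w U)).congr_fderiv ?_
  ext v
  simp [riskGrad]

theorem norm_riskGrad_le (hg : IsSmoothDistortion g B₁ B₂) (hw : ∀ U, 0 ≤ w U) (θ : E) :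
    ‖P.riskGrad g w θ‖ ≤ (∑ U, w U) * (B₁ * K₁) := by
  rw [riskGrad, norm_neg, Finset.sum_mul]
  refine norm_sum_le_of_le _ fun U _ => ?_
  rw [norm_smul, Real.norm_of_nonneg (hw U)]
  refine mul_le_mul_of_nonneg_left ?_ (hw U)
  exact (hg.norm_distDeriv_smul_le (P.eventProb_mem_Icc U θ) P.eventGrad_eq_zero).trans
    (mul_le_mul_of_nonneg_left (P.norm_eventGrad_le U θ) hg.bound_nonneg)

theorem norm_riskGrad_sub_le (hg : IsSmoothDistortion g B₁ B₂) (hw : ∀ U, 0 ≤ w U) (θ η : E) :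
    ‖P.riskGrad g w θ - P.riskGrad g w η‖ ≤
      (∑ U, w U) * (B₁ * (K₂ + K₁ ^ 2) + B₂ * K₁ ^ 2) * ‖θ - η‖ := by
  have hB₁ := hg.bound_nonneg
  have hB₂ := hg.lipschitz_nonneg
  have hK₁ := P.score_bound_nonneg
  rw [riskGrad, riskGrad, ← norm_neg, neg_sub_neg, neg_sub, ← Finset.sum_sub_distrib, mul_assoc,
    Finset.sum_mul]
  refine norm_sum_le_of_le _ fun U _ => ?_
  rw [← smul_sub, norm_smul, Real.norm_of_nonneg (hw U)]
  refine mul_le_mul_of_nonneg_left ?_ (hw U)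
  calc _ ≤ B₁ * ‖P.eventGrad U θ - P.eventGrad U η‖ +
        B₂ * |P.eventProb U θ - P.eventProb U η| * ‖P.eventGrad U η‖ :=
      hg.norm_distDeriv_smul_sub_le (P.eventProb_mem_Icc U θ) (P.eventProb_mem_Icc U η)
        P.eventGrad_eq_zero P.eventGrad_eq_zero
    _ ≤ B₁ * ((K₂ + K₁ ^ 2) * ‖θ - η‖) + B₂ * (K₁ * ‖θ - η‖) * K₁ := by
        gcongr
        · exact P.norm_eventGrad_sub_le U θ η
        · exact P.abs_eventProb_sub_le U θ η
        · exact P.norm_eventGrad_le U η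
    _ = _ := by ring

theorem bddAbove_range_risk (hg : IsSmoothDistortion g B₁ B₂) (hw : ∀ U, 0 ≤ w U) :
    BddAbove (range (P.risk g w)) := by
  obtain ⟨c, hc⟩ := hg.bddAbove_image
  refine ⟨∑ U, w U * c, ?_⟩
  rintro _ ⟨θ, rfl⟩
  refine Finset.sum_le_sum fun U _ => mul_le_mul_of_nonneg_left (hc ⟨_, ?_, rfl⟩) (hw U)
  exact Icc.mem_iff_one_sub_mem.1 (P.eventProb_mem_Icc U θ)

end Risk

section Estimate

variable {m : ℕ}

open Classical in
/-- The empirical probability of the event `U`. -/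
noncomputable def empProb (v : Fin m → Ω) (U : Finset Ω) : ℝ :=
  (m : ℝ)⁻¹ * ∑ i, if v i ∈ U then 1 else 0

open Classical in
/-- The likelihood-ratio estimate of the gradient of the probability of the event `U`. -/
noncomputable def empGrad (θ : E) (v : Fin m → Ω) (U : Finset Ω) : E :=
  (m : ℝ)⁻¹ • ∑ i, if v i ∈ U then P.score (v i) θ else 0

/-- The plug-in estimate of `LikelihoodModel.riskGrad` from `m` samples. -/
noncomputable def riskGradEstimate (g : ℝ → ℝ) (w : Finset Ω → ℝ) (θ : E) (v : Fin m → Ω) : E :=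
  -∑ U, w U • distDeriv g (1 - empProb v U) • P.empGrad θ v U

omit [Fintype Ω] in
theorem empProb_mem_Icc (v : Fin m → Ω) (U : Finset Ω) : empProb v U ∈ Icc (0 : ℝ) 1 := by
  classical
  rw [empProb, Finset.sum_boole]
  refine ⟨by positivity, inv_mul_le_one_of_le₀ ?_ (Nat.cast_nonneg m)⟩
  exact_mod_cast (Finset.card_filter_le _ _).trans_eq (Finset.card_fin m)

theorem empGrad_eq_zero {θ : E} {v : Fin m → Ω} {U : Finset Ω} (h : empProb v U = 0) :
    P.empGrad θ v U = 0 := by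
  classical
  rw [empProb, Finset.sum_boole, mul_eq_zero, inv_eq_zero, Nat.cast_eq_zero, Nat.cast_eq_zero,
    Finset.card_eq_zero, Finset.filter_eq_empty_iff] at h
  rcases h with rfl | h
  · simp [empGrad]
  · rw [empGrad, Finset.sum_eq_zero fun i hi => if_neg (h hi), smul_zero]

theorem iidExpectation_sq_abs_empProb_sub_le (θ : E) (hm : m ≠ 0) (U : Finset Ω) :
    iidExpectation (P.prob θ) m (fun v => |empProb v U - P.eventProb U θ| ^ 2) ≤ 1 / m := by
  classical
  have h := iidExpectation_sq_norm_mean_sub_le (fun ω => (P.prob_pos θ ω).le) (P.sum_prob θ)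
    (X := fun ω => if ω ∈ U then (1 : ℝ) else 0) (K := 1) (fun ω => by split_ifs <;> simp) hm
  simpa [empProb, eventProb] using h

theorem iidExpectation_sq_norm_empGrad_sub_le (θ : E) (hm : m ≠ 0) (U : Finset Ω) :
    iidExpectation (P.prob θ) m (fun v => ‖P.empGrad θ v U - P.eventGrad U θ‖ ^ 2) ≤
      K₁ ^ 2 / m := by
  classical
  have h := iidExpectation_sq_norm_mean_sub_le (fun ω => (P.prob_pos θ ω).le) (P.sum_prob θ)
    (X := fun ω => if ω ∈ U then P.score ω θ else 0) (K := K₁)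
    (fun ω => by split_ifs <;> simp [P.score_bound_nonneg, P.norm_score_le]) hm
  simpa [empGrad, eventGrad, smul_ite, Finset.sum_ite_mem] using h

variable {g : ℝ → ℝ} {w : Finset Ω → ℝ} {B₁ B₂ : ℝ}

theorem sq_norm_riskGradEstimate_sub_le (hg : IsSmoothDistortion g B₁ B₂) (hw : ∀ U, 0 ≤ w U)
    (θ : E) (v : Fin m → Ω) :
    ‖P.riskGradEstimate g w θ v - P.riskGrad g w θ‖ ^ 2 ≤
      (∑ U, w U) * ∑ U, w U * (2 * B₁ ^ 2 * ‖P.empGrad θ v U - P.eventGrad U θ‖ ^ 2 +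
        2 * B₂ ^ 2 * K₁ ^ 2 * |empProb v U - P.eventProb U θ| ^ 2) := by
  have hB₂ := hg.lipschitz_nonneg
  rw [riskGradEstimate, riskGrad, ← norm_neg, neg_sub_neg, neg_sub, ← Finset.sum_sub_distrib]
  simp_rw [← smul_sub]
  refine (sq_norm_sum_smul_le hw _).trans ?_
  refine mul_le_mul_of_nonneg_left (Finset.sum_le_sum fun U _ => ?_)
    (Finset.sum_nonneg fun U _ => hw U)
  refine mul_le_mul_of_nonneg_left ?_ (hw U)
  calc _ ≤ (B₁ * ‖P.empGrad θ v U - P.eventGrad U θ‖ +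
        B₂ * |empProb v U - P.eventProb U θ| * ‖P.eventGrad U θ‖) ^ 2 := by
        gcongr
        exact hg.norm_distDeriv_smul_sub_le (empProb_mem_Icc v U) (P.eventProb_mem_Icc U θ)
          P.empGrad_eq_zero P.eventGrad_eq_zero
    _ ≤ 2 * ((B₁ * ‖P.empGrad θ v U - P.eventGrad U θ‖) ^ 2 +
        (B₂ * |empProb v U - P.eventProb U θ| * ‖P.eventGrad U θ‖) ^ 2) := add_sq_le
    _ ≤ 2 * ((B₁ * ‖P.empGrad θ v U - P.eventGrad U θ‖) ^ 2 +
        (B₂ * |empProb v U - P.eventProb U θ| * K₁) ^ 2) := by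
        gcongr
        exact P.norm_eventGrad_le U θ
    _ = _ := by ring

theorem iidExpectation_sq_norm_riskGradEstimate_sub_le (hg : IsSmoothDistortion g B₁ B₂)
    (hw : ∀ U, 0 ≤ w U) (θ : E) (hm : m ≠ 0) :
    iidExpectation (P.prob θ) m
        (fun v => ‖P.riskGradEstimate g w θ v - P.riskGrad g w θ‖ ^ 2) ≤
      (∑ U, w U) ^ 2 * K₁ ^ 2 * (2 * (B₁ ^ 2 + B₂ ^ 2)) / m := by
  refine (iidExpectation_mono (fun ω => (P.prob_pos θ ω).le)
    (P.sq_norm_riskGradEstimate_sub_le hg hw θ)).trans ?_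
  simp_rw [iidExpectation_const_mul, iidExpectation_sum, iidExpectation_const_mul,
    iidExpectation_add, iidExpectation_const_mul]
  have hW : 0 ≤ ∑ U, w U := Finset.sum_nonneg fun U _ => hw U
  calc _ ≤ (∑ U, w U) *
        ∑ U, w U * (2 * B₁ ^ 2 * (K₁ ^ 2 / m) + 2 * B₂ ^ 2 * K₁ ^ 2 * (1 / m)) := by
        gcongr with U
        · exact hw U
        · exact P.iidExpectation_sq_norm_empGrad_sub_le θ hm U
        · exact P.iidExpectation_sq_abs_empProb_sub_le θ hm U
    _ = _ := by rw [← Finset.sum_mul]; ring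

end Estimate

end LikelihoodModel

namespace EpisodicMDP

variable {S A : Type*} (M : EpisodicMDP S A)

open Classical in
theorem episodeProb_ne_zero {q q' : S → PMF A} (hq' : ∀ s a, q' s a ≠ 0) {s : S}
    {ω : Episode S A} (h : M.episodeProb q s ω ≠ 0) : M.episodeProb q' s ω ≠ 0 := by
  unfold episodeProb at h ⊢
  split_ifs at h ⊢ with hpath
  · rw [Finset.prod_ne_zero_iff] at h ⊢
    exact fun t ht => mul_ne_zero (hq' _ _) (right_ne_zero_of_mul (h t ht))
  · exact absurd rfl h

theorem support_episodeLaw_subset {q q' : S → PMF A} (hq' : ∀ s a, q' s a ≠ 0)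
    (hnone : none ∉ (M.episodeLaw q).support) :
    (M.episodeLaw q).support ⊆ (M.episodeLaw q').support := by
  rintro (_ | ω) h
  · exact absurd h hnone
  · exact (PMF.mem_support_iff _ _).2 (M.episodeProb_ne_zero hq' ((PMF.mem_support_iff _ _).1 h))

theorem exists_eq_some_of_episodeLength_le {K : ℝ} (hK : 0 ≤ K) {o : Option (Episode S A)}
    (ho : episodeLength o ≤ ENNReal.ofReal K) : ∃ ω : Episode S A, o = some ω ∧ (ω.1 : ℝ) ≤ K := by
  rcases o with _ | ω
  · exact absurd (top_le_iff.1 ho) ENNReal.ofReal_ne_top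
  · refine ⟨ω, rfl, ?_⟩
    rwa [episodeLength, ← ENNReal.ofReal_natCast, ENNReal.ofReal_le_ofReal_iff hK] at ho

theorem finite_setOf_episodeLength_le [Finite S] [Finite A] {K : ℝ} (hK : 0 ≤ K) :
    {o : Option (Episode S A) | episodeLength o ≤ ENNReal.ofReal K}.Finite := by
  let ofBoundedEpisode :
      (Σ n : Fin (⌊K⌋₊ + 1), (Fin (n + 1) → S) × (Fin n → A)) → Option (Episode S A) :=
    fun ω => some ⟨ω.1, ω.2⟩
  refine (finite_range ofBoundedEpisode).subset fun o ho => ?_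
  obtain ⟨⟨n, path⟩, rfl, hn⟩ := exists_eq_some_of_episodeLength_le hK ho
  exact ⟨⟨⟨n, Nat.lt_succ_of_le (Nat.le_floor hn)⟩, path⟩, rfl⟩

end EpisodicMDP

section Policy

variable {S A : Type*} {d : ℕ} (M : EpisodicMDP S A) {π : Param d → S → PMF A}

theorem toReal_policy_eq_exp_logPolicy (hpos : ∀ θ s a, π θ s a ≠ 0) (θ : Param d) (s : S)
    (a : A) : (π θ s a).toReal = Real.exp (logPolicy π s a θ) :=
  (Real.exp_log (ENNReal.toReal_pos (hpos θ s a) ((π θ s).apply_ne_top a))).symm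

theorem exists_toReal_episodeProb_eq_const_mul_exp (hpos : ∀ θ s a, π θ s a ≠ 0)
    (ω : Episode S A) (s₀ : S) :
    ∃ c : ℝ, ∀ θ, (M.episodeProb (π θ) s₀ ω).toReal =
      c * Real.exp (∑ t : Fin ω.1, logPolicy π (ω.2.1 t.castSucc) (ω.2.2 t) θ) := by
  classical
  unfold EpisodicMDP.episodeProb
  split_ifs
  · refine ⟨∏ t : Fin ω.1,
      (M.trans (ω.2.1 t.castSucc) (ω.2.2 t) (ω.2.1 t.succ)).toReal, fun θ => ?_⟩
    simp_rw [Finset.prod_mul_distrib, ENNReal.toReal_mul, ENNReal.toReal_prod,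
      toReal_policy_eq_exp_logPolicy hpos, Real.exp_sum]
    exact mul_comm _ _
  · exact ⟨0, by simp⟩

theorem hasGradientAt_toReal_episodeProb (hpos : ∀ θ s a, π θ s a ≠ 0)
    (hdiff : ∀ s a, Differentiable ℝ (logPolicy π s a)) (ω : Episode S A) (s₀ : S)
    (θ : Param d) :
    HasGradientAt (fun θ => (M.episodeProb (π θ) s₀ ω).toReal)
      ((M.episodeProb (π θ) s₀ ω).toReal • episodeScore π θ (some ω)) θ := by
  obtain ⟨c, hc⟩ := exists_toReal_episodeProb_eq_const_mul_exp M hpos ω s₀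
  simp_rw [hc]
  rw [hasGradientAt_iff_hasFDerivAt]
  refine (((HasFDerivAt.fun_sum (u := Finset.univ) fun (t : Fin ω.1) _ =>
    (hdiff (ω.2.1 t.castSucc) (ω.2.2 t) θ).hasGradientAt.hasFDerivAt).exp).const_mul
      c).congr_fderiv ?_
  ext v
  simp [episodeScore, mul_assoc]

theorem norm_episodeScore_le {Md : ℝ} (hgrad : ∀ θ s a, ‖gradient (logPolicy π s a) θ‖ ≤ Md)
    (ω : Episode S A) (θ : Param d) : ‖episodeScore π θ (some ω)‖ ≤ ω.1 * Md := by
  simpa [episodeScore] using norm_sum_le_of_le (Finset.univ : Finset (Fin ω.1))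
    fun t _ => hgrad θ (ω.2.1 t.castSucc) (ω.2.2 t)

theorem hasFDerivAt_episodeScore
    (hdiff₂ : ∀ s a, Differentiable ℝ (gradient (logPolicy π s a))) (ω : Episode S A)
    (θ : Param d) : HasFDerivAt (fun θ => episodeScore π θ (some ω))
      (∑ t : Fin ω.1, fderiv ℝ (gradient (logPolicy π (ω.2.1 t.castSucc) (ω.2.2 t))) θ) θ :=
  HasFDerivAt.fun_sum fun t _ => (hdiff₂ (ω.2.1 t.castSucc) (ω.2.2 t) θ).hasFDerivAt

theorem norm_fderiv_episodeScore_le {Mh : ℝ}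
    (hdiff₂ : ∀ s a, Differentiable ℝ (gradient (logPolicy π s a)))
    (hhess : ∀ θ s a, ‖fderiv ℝ (gradient (logPolicy π s a)) θ‖ ≤ Mh)
    (ω : Episode S A) (θ : Param d) :
    ‖fderiv ℝ (fun θ => episodeScore π θ (some ω)) θ‖ ≤ ω.1 * Mh := by
  rw [(hasFDerivAt_episodeScore hdiff₂ ω θ).fderiv]
  simpa using norm_sum_le_of_le (Finset.univ : Finset (Fin ω.1))
    fun t _ => hhess θ (ω.2.1 t.castSucc) (ω.2.2 t)

end Policy

/-- The regularity of a policy class required by the policy gradient method: the length of an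
episode is almost surely at most `Me` whatever the parameter, and all actions have positive
probability, with log-probabilities twice differentiable in the parameter, of gradient bounded by
`Md` and Hessian bounded by `Mh`. -/
structure IsRegularPolicy {S A : Type*} {d : ℕ} (M : EpisodicMDP S A) (π : Param d → S → PMF A)
    (Me Md Mh : ℝ) : Prop where
  horizon_nonneg : 0 ≤ Me
  episodeLength_le : ∀ θ, ∀ ω ∈ (M.episodeLaw (π θ)).support,
    EpisodicMDP.episodeLength ω ≤ ENNReal.ofReal Me
  ne_zero : ∀ θ s a, π θ s a ≠ 0
  differentiable_logPolicy : ∀ s a, Differentiable ℝ (logPolicy π s a)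
  differentiable_gradient : ∀ s a, Differentiable ℝ (gradient (logPolicy π s a))
  norm_gradient_le : ∀ θ s a, ‖gradient (logPolicy π s a) θ‖ ≤ Md
  norm_hessian_le : ∀ θ s a, ‖fderiv ℝ (gradient (logPolicy π s a)) θ‖ ≤ Mh

/-- The episodes, unending ones included, that have positive probability for some parameter. For a
regular policy they have positive probability for every parameter, so that this set carries all
episode laws at once. -/
def possibleEpisodes {S A : Type*} {d : ℕ} (M : EpisodicMDP S A) (π : Param d → S → PMF A) :
    Set (Option (Episode S A)) :=
  ⋃ θ, (M.episodeLaw (π θ)).support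

namespace IsRegularPolicy

variable {S A : Type*} {d : ℕ} {M : EpisodicMDP S A} {π : Param d → S → PMF A} {Me Md Mh : ℝ}
  (hπ : IsRegularPolicy M π Me Md Mh)

include hπ

theorem gradient_bound_nonneg : 0 ≤ Md :=
  have ⟨a, _⟩ := (π 0 M.start).support_nonempty
  (norm_nonneg _).trans (hπ.norm_gradient_le 0 M.start a)

theorem hessian_bound_nonneg : 0 ≤ Mh :=
  have ⟨a, _⟩ := (π 0 M.start).support_nonempty
  (norm_nonneg _).trans (hπ.norm_hessian_le 0 M.start a)

theorem exists_eq_some {o : Option (Episode S A)} (ho : o ∈ possibleEpisodes M π) :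
    ∃ ω : Episode S A, o = some ω ∧ (ω.1 : ℝ) ≤ Me :=
  have ⟨θ, hθ⟩ := mem_iUnion.1 ho
  EpisodicMDP.exists_eq_some_of_episodeLength_le hπ.horizon_nonneg (hπ.episodeLength_le θ o hθ)

theorem support_episodeLaw (θ : Param d) :
    (M.episodeLaw (π θ)).support = possibleEpisodes M π := by
  refine (subset_iUnion (fun θ => (M.episodeLaw (π θ)).support) θ).antisymm
    (iUnion_subset fun η => M.support_episodeLaw_subset (hπ.ne_zero θ) fun hnone => ?_)
  obtain ⟨_, hsome, _⟩ := hπ.exists_eq_some (mem_iUnion_of_mem η hnone)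
  cases hsome

theorem finite_possibleEpisodes [Finite S] [Finite A] : (possibleEpisodes M π).Finite :=
  (EpisodicMDP.finite_setOf_episodeLength_le hπ.horizon_nonneg).subset
    (iUnion_subset hπ.episodeLength_le)

/-- The episode laws of a regular policy as a likelihood model on the possible episodes. -/
noncomputable def model [Fintype (possibleEpisodes M π)] :
    LikelihoodModel (Param d) (possibleEpisodes M π) (Me * Md) (Me * Mh) where
  prob θ ω := (M.episodeLaw (π θ) ω).toReal
  score ω θ := episodeScore π θ ω
  prob_pos θ ω := ENNReal.toReal_pos
    ((PMF.mem_support_iff _ _).1 ((hπ.support_episodeLaw θ).symm ▸ ω.2)) (PMF.apply_ne_top _ _)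
  sum_prob θ := by
    have htsum : ∑' ω : possibleEpisodes M π, M.episodeLaw (π θ) ω = 1 :=
      (tsum_subtype_eq_of_support_subset (hπ.support_episodeLaw θ).subset).trans (PMF.tsum_coe _)
    rw [← ENNReal.toReal_sum fun ω _ => PMF.apply_ne_top _ _, ← ENNReal.toReal_one, ← htsum,
      tsum_fintype]
  hasGradientAt := by
    rintro θ ⟨o, ho⟩
    obtain ⟨ω, rfl, -⟩ := hπ.exists_eq_some ho
    exact hasGradientAt_toReal_episodeProb M hπ.ne_zero hπ.differentiable_logPolicy ω M.start θ
  differentiable_score := by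
    rintro ⟨o, ho⟩ θ
    obtain ⟨ω, rfl, -⟩ := hπ.exists_eq_some ho
    exact (hasFDerivAt_episodeScore hπ.differentiable_gradient ω θ).differentiableAt
  norm_score_le := by
    rintro ⟨o, ho⟩ θ
    obtain ⟨ω, rfl, hlength⟩ := hπ.exists_eq_some ho
    exact (norm_episodeScore_le hπ.norm_gradient_le ω θ).trans
      (mul_le_mul_of_nonneg_right hlength hπ.gradient_bound_nonneg)
  norm_fderiv_score_le := by
    rintro ⟨o, ho⟩ θ
    obtain ⟨ω, rfl, hlength⟩ := hπ.exists_eq_some ho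
    exact (norm_fderiv_episodeScore_le hπ.differentiable_gradient hπ.norm_hessian_le ω θ).trans
      (mul_le_mul_of_nonneg_right hlength hπ.hessian_bound_nonneg)

end IsRegularPolicy

section LevelWeight

variable {S A : Type*} {d : ℕ} (M : EpisodicMDP S A) (π : Param d → S → PMF A) (γ : ℝ) {Mr : ℝ}
  [Fintype (possibleEpisodes M π)]

/-- The weights that turn the distortion risk measure of the reward into a
`LikelihoodModel.risk`: `levelWeight M π γ Mr U` is the length of the set of reward levels
`x ∈ [-Mr, Mr]` for which `U` is the set of possible episodes of reward at most `x`. -/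
noncomputable def levelWeight (Mr : ℝ) : Finset (possibleEpisodes M π) → ℝ :=
  sublevelWeight (fun ω : possibleEpisodes M π => M.discountedReward γ ω) (-Mr) Mr

theorem levelWeight_nonneg (Mr : ℝ) (U : Finset (possibleEpisodes M π)) :
    0 ≤ levelWeight M π γ Mr U :=
  sublevelWeight_nonneg _ _ _ U

theorem sum_levelWeight (hMr : 0 ≤ Mr) : ∑ U, levelWeight M π γ Mr U = 2 * Mr := by
  unfold levelWeight
  rw [sum_sublevelWeight _ (by linarith)]
  ring

end LevelWeight

namespace IsRegularPolicy

variable {S A : Type*} {d : ℕ} {M : EpisodicMDP S A} {π : Param d → S → PMF A} {Me Md Mh : ℝ}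
  (hπ : IsRegularPolicy M π Me Md Mh) (g : ℝ → ℝ) (γ : ℝ) {Mr : ℝ}

section Fintype

variable [Fintype (possibleEpisodes M π)]

theorem rewardCDF_eq_eventProb (θ : Param d) (x : ℝ) :
    M.rewardCDF (π θ) γ x = hπ.model.eventProb
      (sublevel (fun ω : possibleEpisodes M π => M.discountedReward γ ω) x) θ := by
  classical
  set p : Option (Episode S A) → ℝ≥0∞ :=
    (M.discountedReward γ ⁻¹' Iic x).indicator (M.episodeLaw (π θ)) with hp
  have hsupp : Function.support p ⊆ possibleEpisodes M π := by
    rw [support_indicator, ← hπ.support_episodeLaw θ]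
    exact inter_subset_right
  have htop : ∀ ω, p ω ≠ ⊤ := fun ω =>
    ((indicator_le_self _ _ ω).trans_lt (PMF.apply_lt_top _ ω)).ne
  rw [EpisodicMDP.rewardCDF, ProbabilityTheory.cdf_eq_real, measureReal_def,
    PMF.toMeasure_apply_eq_toOuterMeasure_apply _ measurableSet_Iic, PMF.toOuterMeasure_map_apply,
    PMF.toOuterMeasure_apply, ← hp, ← tsum_subtype_eq_of_support_subset hsupp, tsum_fintype,
    ENNReal.toReal_sum fun (ω : possibleEpisodes M π) _ => htop ω, LikelihoodModel.eventProb,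
    sublevel, Finset.sum_filter]
  refine Finset.sum_congr rfl fun ω _ => ?_
  simp only [hp, indicator_apply, mem_preimage, mem_Iic]
  split_ifs
  · rfl
  · exact ENNReal.toReal_zero

theorem drm_eq_risk (hMr : 0 ≤ Mr) (θ : Param d) :
    drm M π g γ Mr θ = hπ.model.risk g (levelWeight M π γ Mr) θ - Mr := by
  set R : possibleEpisodes M π → ℝ := fun ω => M.discountedReward γ ω
  have hint := intervalIntegrable_comp_sublevel R (fun U => g (1 - hπ.model.eventProb U θ))
  unfold drm
  simp_rw [hπ.rewardCDF_eq_eventProb γ θ]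
  rw [intervalIntegral.integral_sub (hint _ _) intervalIntegrable_const, sub_add_eq_add_sub,
    intervalIntegral.integral_add_adjacent_intervals (hint _ _) (hint _ _),
    integral_comp_sublevel R (fun U => g (1 - hπ.model.eventProb U θ)) (by linarith)]
  simp [LikelihoodModel.risk, levelWeight, R]

theorem drmGradEstimate_eq_riskGradEstimate (hMr : 0 ≤ Mr) (θ : Param d) {m : ℕ}
    (v : Fin m → possibleEpisodes M π) :
    drmGradEstimate M π g γ Mr θ (fun i => v i) =
      hπ.model.riskGradEstimate g (levelWeight M π γ Mr) θ v := by
  classical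
  set R : possibleEpisodes M π → ℝ := fun ω => M.discountedReward γ ω
  have hempCDF (x : ℝ) : empCDF M γ (fun i => (v i : Option (Episode S A))) x =
      LikelihoodModel.empProb v (sublevel R x) := by
    simp [empCDF, LikelihoodModel.empProb, mem_sublevel, R]
  have hempGradCDF (x : ℝ) : empGradCDF M π γ θ (fun i => (v i : Option (Episode S A))) x =
      hπ.model.empGrad θ v (sublevel R x) := by
    simp [empGradCDF, LikelihoodModel.empGrad, mem_sublevel, R, model]
  unfold drmGradEstimate
  simp_rw [hempCDF, hempGradCDF]
  rw [integral_comp_sublevel R (fun U => distDeriv g (1 - LikelihoodModel.empProb v U) •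
    hπ.model.empGrad θ v U) (by linarith)]
  rfl

variable {g} {B₁ B₂ : ℝ}

theorem hasGradientAt_drm_riskGrad (hg : IsSmoothDistortion g B₁ B₂) (hMr : 0 ≤ Mr)
    (θ : Param d) :
    HasGradientAt (drm M π g γ Mr) (hπ.model.riskGrad g (levelWeight M π γ Mr) θ) θ := by
  rw [funext (hπ.drm_eq_risk g γ hMr), hasGradientAt_iff_hasFDerivAt]
  exact (hπ.model.hasGradientAt_risk hg θ).hasFDerivAt.sub_const Mr

end Fintype

variable [Finite (possibleEpisodes M π)] {g} {B₁ B₂ : ℝ} (hg : IsSmoothDistortion g B₁ B₂)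

include hπ hg

theorem differentiable_drm (hMr : 0 ≤ Mr) : Differentiable ℝ (drm M π g γ Mr) := fun θ =>
  have := Fintype.ofFinite (possibleEpisodes M π)
  (hπ.hasGradientAt_drm_riskGrad γ hg hMr θ).differentiableAt

theorem bddAbove_range_drm (hMr : 0 ≤ Mr) : BddAbove (range (drm M π g γ Mr)) := by
  have := Fintype.ofFinite (possibleEpisodes M π)
  obtain ⟨c, hc⟩ := hπ.model.bddAbove_range_risk hg
    (levelWeight_nonneg M π γ Mr)
  refine ⟨c - Mr, ?_⟩
  rintro _ ⟨θ, rfl⟩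
  rw [hπ.drm_eq_risk g γ hMr]
  exact sub_le_sub_right (hc ⟨θ, rfl⟩) Mr

theorem norm_gradient_drm_le (hMr : 0 ≤ Mr) (θ : Param d) :
    ‖gradient (drm M π g γ Mr) θ‖ ≤ 2 * Mr * (B₁ * (Me * Md)) := by
  have := Fintype.ofFinite (possibleEpisodes M π)
  rw [(hπ.hasGradientAt_drm_riskGrad γ hg hMr θ).gradient, ← sum_levelWeight M π γ hMr]
  exact hπ.model.norm_riskGrad_le hg (levelWeight_nonneg M π γ Mr) θ

theorem norm_gradient_drm_sub_le (hMr : 0 ≤ Mr) (θ η : Param d) :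
    ‖gradient (drm M π g γ Mr) θ - gradient (drm M π g γ Mr) η‖ ≤
      2 * Mr * Me * (Mh * B₁ + Me * Md ^ 2 * (B₁ + B₂)) * ‖θ - η‖ := by
  have := Fintype.ofFinite (possibleEpisodes M π)
  rw [(hπ.hasGradientAt_drm_riskGrad γ hg hMr θ).gradient,
    (hπ.hasGradientAt_drm_riskGrad γ hg hMr η).gradient]
  refine (hπ.model.norm_riskGrad_sub_le hg (levelWeight_nonneg M π γ Mr) θ η).trans_eq ?_
  rw [sum_levelWeight M π γ hMr]
  ring

theorem pmfMean_sq_norm_drmGradEstimate_sub_le (hMr : 0 ≤ Mr) {m : ℕ} (hm : m ≠ 0)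
    (θ : Param d) :
    pmfMean (iidLaw (M.episodeLaw (π θ)) m) (fun w => ENNReal.ofReal
        (‖drmGradEstimate M π g γ Mr θ w - gradient (drm M π g γ Mr) θ‖ ^ 2)) ≤
      ENNReal.ofReal ((2 * Mr) ^ 2 * (Me * Md) ^ 2 * (2 * (B₁ ^ 2 + B₂ ^ 2)) / m) := by
  have := Fintype.ofFinite (possibleEpisodes M π)
  rw [pmfMean_iidLaw (hπ.support_episodeLaw θ).subset fun w => sq_nonneg _,
    (hπ.hasGradientAt_drm_riskGrad γ hg hMr θ).gradient, ← sum_levelWeight M π γ hMr]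
  simp_rw [hπ.drmGradEstimate_eq_riskGradEstimate g γ hMr θ]
  exact ENNReal.ofReal_le_ofReal (hπ.model.iidExpectation_sq_norm_riskGradEstimate_sub_le hg
    (levelWeight_nonneg M π γ Mr) θ hm)

end IsRegularPolicy

theorem div_sqrt_le_of_sq_div_sq_le {C ε x : ℝ} (hε : 0 < ε) (hx : 0 < x)
    (h : C ^ 2 / ε ^ 2 ≤ x) : C / √x ≤ ε := by
  rw [div_le_iff₀ (Real.sqrt_pos.2 hx), ← div_le_iff₀' hε]
  exact Real.le_sqrt_of_sq_le (by rwa [div_pow])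

theorem ascent_bound_sqrt_schedule_le {N : ℕ} (hN : 1 ≤ N) (Δ : ℝ) {V : ℝ} (hV : 0 ≤ V) :
    (2 / (1 / √(N : ℝ)) * Δ + (N + 1) * (V / ⌈√(N : ℝ)⌉₊)) / N ≤ (2 * Δ + 2 * V) / √(N : ℝ) := by
  have hN' : (1 : ℝ) ≤ N := by exact_mod_cast hN
  have hsq : √(N : ℝ) ^ 2 = N := Real.sq_sqrt (by linarith)
  calc _ ≤ (2 / (1 / √(N : ℝ)) * Δ + (2 * N) * (V / √(N : ℝ))) / N := by
        gcongr
        · linarith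
        · exact Nat.le_ceil _
    _ = (2 / (1 / √(N : ℝ)) * Δ + (2 * √(N : ℝ) ^ 2) * (V / √(N : ℝ))) / √(N : ℝ) ^ 2 := by
        rw [hsq]
    _ = (2 * Δ + 2 * V) / √(N : ℝ) := by field_simp

namespace IsRegularPolicy

variable {S A : Type*} {d : ℕ} {M : EpisodicMDP S A} {π : Param d → S → PMF A} {Me Md Mh : ℝ}
  (hπ : IsRegularPolicy M π Me Md Mh) [Finite (possibleEpisodes M π)] {g : ℝ → ℝ} {B₁ B₂ : ℝ}
  (hg : IsSmoothDistortion g B₁ B₂) (γ : ℝ) {Mr : ℝ} (hMr : 0 ≤ Mr)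

include hπ hg hMr

theorem meanSqGrad_le (μ : PMF (Param d)) :
    meanSqGrad M π g γ Mr μ ≤ ENNReal.ofReal ((2 * Mr * (B₁ * (Me * Md))) ^ 2) := by
  rw [← pmfMean_const μ (ENNReal.ofReal _)]
  refine pmfMean_mono μ fun θ => ENNReal.ofReal_le_ofReal ?_
  exact pow_le_pow_left₀ (norm_nonneg _) (hπ.norm_gradient_drm_le γ hg hMr θ) 2

theorem meanSqGrad_outputLaw_le {α L : ℝ} (hα : 0 < α)
    (hL : L = 2 * Mr * Me * (Mh * B₁ + Me * Md ^ 2 * (B₁ + B₂))) (hαL : α * L ≤ 1)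
    {m : ℕ} (hm : m ≠ 0) (θ₀ : Param d) (N : ℕ) (hN : 1 ≤ N) :
    meanSqGrad M π g γ Mr (outputLaw M π g γ Mr α m θ₀ N hN) ≤
      ENNReal.ofReal ((2 / α * ((⨆ θ, drm M π g γ Mr θ) - drm M π g γ Mr θ₀) +
        (N + 1) * ((2 * Mr) ^ 2 * (Me * Md) ^ 2 * (2 * (B₁ ^ 2 + B₂ ^ 2)) / m)) / N) :=
  pmfMean_uniform_iterate_sq_norm_gradient_le
    (fun θ => (hπ.differentiable_drm γ hg hMr θ).hasGradientAt)
    (hL ▸ hπ.norm_gradient_drm_sub_le γ hg hMr) hα hαL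
    (le_ciSup (hπ.bddAbove_range_drm γ hg hMr)) (by positivity)
    (hπ.pmfMean_sq_norm_drmGradEstimate_sub_le γ hg hMr hm) rfl (fun _ => rfl) _

theorem meanSqGrad_outputLaw_sqrt_schedule_le {L C : ℝ}
    (hL : L = 2 * Mr * Me * (Mh * B₁ + Me * Md ^ 2 * (B₁ + B₂))) (θ₀ : Param d)
    (hC : C = 2 * ((⨆ θ, drm M π g γ Mr θ) - drm M π g γ Mr θ₀) +
      4 * Mr ^ 2 * Me ^ 2 * Md ^ 2 *
        (B₁ ^ 2 * L + 8 * (Real.exp 1 ^ 2 * B₁ ^ 2 + B₂ ^ 2)))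
    (N : ℕ) (hN : 1 ≤ N) :
    meanSqGrad M π g γ Mr (outputLaw M π g γ Mr (1 / √(N : ℝ)) ⌈√(N : ℝ)⌉₊ θ₀ N hN) ≤
      ENNReal.ofReal (C / √(N : ℝ)) := by
  have hr : 0 < √(N : ℝ) := Real.sqrt_pos.2 (by exact_mod_cast hN)
  rcases le_total √(N : ℝ) L with hsmall | hlarge
  · -- The step size may exceed `1 / L` here, but the trivial bound on the gradient is good enough.
    refine (hπ.meanSqGrad_le hg γ hMr _).trans (ENNReal.ofReal_le_ofReal ?_)
    have hgap : 0 ≤ (⨆ θ, drm M π g γ Mr θ) - drm M π g γ Mr θ₀ :=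
      sub_nonneg.2 (le_ciSup (hπ.bddAbove_range_drm γ hg hMr) θ₀)
    rw [le_div_iff₀ hr, hC]
    calc (2 * Mr * (B₁ * (Me * Md))) ^ 2 * √(N : ℝ)
        ≤ (2 * Mr * (B₁ * (Me * Md))) ^ 2 * L := by gcongr
      _ = 4 * Mr ^ 2 * Me ^ 2 * Md ^ 2 * (B₁ ^ 2 * L) := by ring
      _ ≤ 4 * Mr ^ 2 * Me ^ 2 * Md ^ 2 *
          (B₁ ^ 2 * L + 8 * (Real.exp 1 ^ 2 * B₁ ^ 2 + B₂ ^ 2)) := by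
          gcongr
          exact le_add_of_nonneg_right (by positivity)
      _ ≤ _ := le_add_of_nonneg_left (by positivity)
  · have hαL : 1 / √(N : ℝ) * L ≤ 1 := by
      rw [one_div_mul_eq_div]
      exact (div_le_one hr).2 hlarge
    have hL₀ : 0 ≤ L := by
      have hMe := hπ.horizon_nonneg
      have hMh := hπ.hessian_bound_nonneg
      have hB₁ := hg.bound_nonneg
      have hB₂ := hg.lipschitz_nonneg
      rw [hL]
      positivity
    have hexp : (1 : ℝ) ≤ Real.exp 1 ^ 2 := one_le_pow₀ (Real.one_le_exp zero_le_one)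
    refine (hπ.meanSqGrad_outputLaw_le hg γ hMr (one_div_pos.2 hr) hL hαL
      (Nat.ceil_pos.2 hr).ne' θ₀ N hN).trans (ENNReal.ofReal_le_ofReal ?_)
    refine (ascent_bound_sqrt_schedule_le hN _ (by positivity)).trans ?_
    rw [hC]
    refine div_le_div_of_nonneg_right (add_le_add_right ?_ _) hr.le
    calc 2 * ((2 * Mr) ^ 2 * (Me * Md) ^ 2 * (2 * (B₁ ^ 2 + B₂ ^ 2)))
        = 4 * Mr ^ 2 * Me ^ 2 * Md ^ 2 * (0 + 4 * (1 * B₁ ^ 2 + B₂ ^ 2)) := by ring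
      _ ≤ _ := by
          gcongr
          · positivity
          · norm_num

end IsRegularPolicy

theorem mainTheorem4_general {S A : Type*} {d : ℕ} (M : EpisodicMDP S A)
    (π : Param d → S → PMF A) [Finite (possibleEpisodes M π)] (g : ℝ → ℝ)
    (γ Mr Me Md Mg₁ Mg₂ Mh L C : ℝ) (hMr : 0 ≤ Mr) (hπ : IsRegularPolicy M π Me Md Mh)
    (hg : IsSmoothDistortion g Mg₁ Mg₂)
    (hL : L = 2 * Mr * Me * (Mh * Mg₁ + Me * Md ^ 2 * (Mg₁ + Mg₂))) (θ₀ : Param d)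
    (hC : C = 2 * ((⨆ θ, drm M π g γ Mr θ) - drm M π g γ Mr θ₀) +
      4 * Mr ^ 2 * Me ^ 2 * Md ^ 2 *
        (Mg₁ ^ 2 * L + 8 * (Real.exp 1 ^ 2 * Mg₁ ^ 2 + Mg₂ ^ 2))) :
    Differentiable ℝ (drm M π g γ Mr) ∧
    BddAbove (Set.range (drm M π g γ Mr)) ∧
    (∀ (N : ℕ) (hN : 1 ≤ N),
      meanSqGrad M π g γ Mr
          (outputLaw M π g γ Mr (1 / √(N : ℝ)) ⌈√(N : ℝ)⌉₊ θ₀ N hN) ≤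
        ENNReal.ofReal (C / √(N : ℝ))) ∧
    (∀ ε : ℝ, 0 < ε → ∀ (N : ℕ) (hN : 1 ≤ N), C ^ 2 / ε ^ 2 ≤ (N : ℝ) →
      IsStationaryPoint M π g γ Mr ε
        (outputLaw M π g γ Mr (1 / √(N : ℝ)) ⌈√(N : ℝ)⌉₊ θ₀ N hN)) := by
  have hrate := hπ.meanSqGrad_outputLaw_sqrt_schedule_le hg γ hMr hL θ₀ hC
  refine ⟨hπ.differentiable_drm γ hg hMr, hπ.bddAbove_range_drm γ hg hMr, hrate,
    fun ε hε N hN hNε => (hrate N hN).trans (ENNReal.ofReal_le_ofReal ?_)⟩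
  exact div_sqrt_le_of_sq_div_sq_le hε (by exact_mod_cast hN) hNε

theorem mainTheorem4 {S A : Type*} [Finite S] [Finite A] {d : ℕ}
    (M : EpisodicMDP S A) (π : Param d → S → PMF A) (g : ℝ → ℝ)
    (γ rmax Mr Me Md Mg₁ Mg₂ Mh L C : ℝ)
    (hγ₀ : 0 < γ) (hγ₁ : γ < 1)
    (hrmax : 0 < rmax) (hreward : ∀ s a s', |M.reward s a s'| ≤ rmax)
    (hMr : Mr = rmax / (1 - γ))
    -- the episode length is almost surely at most `Me`, whatever the parameter
    (hMe : 0 < Me)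
    (hT : ∀ θ, ∀ ω ∈ (M.episodeLaw (π θ)).support,
      EpisodicMDP.episodeLength ω ≤ ENNReal.ofReal Me)
    -- `log π_θ(a | s)` is defined, twice differentiable, with bounded gradient and Hessian
    (hpos : ∀ θ s a, π θ s a ≠ 0)
    (hdiff : ∀ s a, Differentiable ℝ (logPolicy π s a))
    (hdiff₂ : ∀ s a, Differentiable ℝ (gradient (logPolicy π s a)))
    (hMd : 0 < Md) (hgrad : ∀ θ s a, ‖gradient (logPolicy π s a) θ‖ ≤ Md)
    (hMh : 0 < Mh) (hhess : ∀ θ s a, ‖fderiv ℝ (gradient (logPolicy π s a)) θ‖ ≤ Mh)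
    -- the distortion function is twice differentiable on `(0,1)`, with bounded derivatives,
    -- and has a right derivative at `0`
    (hg : IsDistortion g)
    (hg₀ : DifferentiableWithinAt ℝ g (Set.Icc 0 1) 0)
    (hg₁ : ∀ t ∈ Set.Ioo (0 : ℝ) 1, DifferentiableAt ℝ g t)
    (hg₂ : ∀ t ∈ Set.Ioo (0 : ℝ) 1, DifferentiableAt ℝ (deriv g) t)
    (hMg₁ : 0 < Mg₁) (hg₁_le : ∀ t ∈ Set.Ioo (0 : ℝ) 1, |deriv g t| ≤ Mg₁)
    (hMg₂ : 0 < Mg₂) (hg₂_le : ∀ t ∈ Set.Ioo (0 : ℝ) 1, |deriv (deriv g) t| ≤ Mg₂)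
    (hL : L = 2 * Mr * Me * (Mh * Mg₁ + Me * Md ^ 2 * (Mg₁ + Mg₂)))
    (θ₀ : Param d)
    (hC : C = 2 * ((⨆ θ, drm M π g γ Mr θ) - drm M π g γ Mr θ₀) +
      4 * Mr ^ 2 * Me ^ 2 * Md ^ 2 *
        (Mg₁ ^ 2 * L + 8 * (Real.exp 1 ^ 2 * Mg₁ ^ 2 + Mg₂ ^ 2))) :
    Differentiable ℝ (drm M π g γ Mr) ∧
    BddAbove (Set.range (drm M π g γ Mr)) ∧
    (∀ (N : ℕ) (hN : 1 ≤ N),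
      meanSqGrad M π g γ Mr
          (outputLaw M π g γ Mr (1 / √(N : ℝ)) ⌈√(N : ℝ)⌉₊ θ₀ N hN) ≤
        ENNReal.ofReal (C / √(N : ℝ))) ∧
    (∀ ε : ℝ, 0 < ε → ∀ (N : ℕ) (hN : 1 ≤ N), C ^ 2 / ε ^ 2 ≤ (N : ℝ) →
      IsStationaryPoint M π g γ Mr ε
        (outputLaw M π g γ Mr (1 / √(N : ℝ)) ⌈√(N : ℝ)⌉₊ θ₀ N hN)) := by
  have hMr₀ : 0 ≤ Mr := hMr ▸ div_nonneg hrmax.le (sub_nonneg.2 hγ₁.le)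
  have hπ : IsRegularPolicy M π Me Md Mh := ⟨hMe.le, hT, hpos, hdiff, hdiff₂, hgrad, hhess⟩
  have : Finite (possibleEpisodes M π) := hπ.finite_possibleEpisodes
  exact mainTheorem4_general M π g γ Mr Me Md Mg₁ Mg₂ Mh L C hMr₀ hπ
    (.of_abs_deriv_deriv_le hg₀ hg₁ hg₂ hg₁_le hg₂_le) hL θ₀ hC
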